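/- Let $G=(V,E)$ be a finite simple graph. An order of $V$ is a bijection $r: V\to\{0,\dots,|V|-1\}$, and for $W\subset V$ put $b_r(W)=\max_{w\in W} r(w)-\min_{w\in W} r(w)$. Let $L_2(G)$ be the set of all (not necessarily induced) subgraphs $S=(V_S,E_S)$ of $G$ that are paths with two edges, and define the graph 2-bandwidth $$b^2(G)=\min_{r}\ \max_{S\in L_2(G)} b_r(V_S),$$ the minimum being over all orders $r$ of $V$. A swap layer is a product of pairwise disjoint transpositions of neighbouring positions in $\{0,\dots,|V|-1\}$. A (linear-connectivity) swap network for $G$ of depth $d$ is a sequence of orders $r^{(0)},\dots,r^{(d)}$ of $V$ in which each order arises from the preceding one by a swap layer, and such that for every edge $vw\in E$ there is a $t\in\{0,\dots,d\}$ with $|r^{(t)}(v)-r^{(t)}(w)|=1$. Let $d_{\mathrm{swap}}(G)$ be the minimum depth of a swap network for $G$. A grid graph is a Cartesian product of path graphs, a factor $k$ standing for the path on $k$ vertices. Let $1\le M\le N$ be integers. 1. Let $G$ be the $M\times N$ grid graph. If $N\ge 3$, then $b^2(G)=2M$. For all $1\le M\le N$, $d_{\mathrm{swap}}(G)\ge M-1$.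 2. Let $G$ be the $2\times M\times N$ grid graph. If $N\ge 3$, then $$b^2(G)=\begin{cases}4M & \text{if } M<N,\\ 4M-1 & \text{if } M=N.\end{cases}$$ If $N\ge 2$, then $d_{\mathrm{swap}}(G)\ge 2M-1$. -/

import Mathlib

/-- An order of a finite vertex set `V`: a bijection `V → {0, …, |V| - 1}`. -/
abbrev VertexOrder (V : Type*) [Fintype V] : Type _ := V ≃ Fin (Fintype.card V)

/-- The collection of all subgraphs of `G` which are length-two line graphs, that is, which are
isomorphic to the path on three vertices. -/
def lengthTwoLines {V : Type*} (G : SimpleGraph V) : Set G.Subgraph :=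
  {S | Nonempty (S.coe ≃g SimpleGraph.pathGraph 3)}

/-- The order bandwidth of `W` under `r`: the largest minus the smallest position of an element
of `W`. -/
noncomputable def orderBandwidth {V : Type*} [Fintype V] (r : VertexOrder V) (W : Set V) : ℕ :=
  sSup ((fun w => (r w : ℕ)) '' W) - sInf ((fun w => (r w : ℕ)) '' W)

/-- The graph 2-bandwidth: the minimum over all orders `r` of the maximal order bandwidth under `r`
of (the vertex set of) a length-two line subgraph.  All families involved are finite; the maximum
over an empty family of subgraphs is `0`. -/
noncomputable def twoBandwidth {V : Type*} [Fintype V] (G : SimpleGraph V) : ℕ :=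
  ⨅ r : VertexOrder V, ⨆ S : lengthTwoLines G, orderBandwidth r S.1.verts

/-- A swap layer on `n` linearly arranged positions: a product of pairwise disjoint transpositions
of neighbouring positions, i.e. an involution which moves every position by at most one. -/
def IsSwapLayer {n : ℕ} (σ : Equiv.Perm (Fin n)) : Prop :=
  (∀ i, σ (σ i) = i) ∧ ∀ i, (σ i : ℕ) ≤ (i : ℕ) + 1 ∧ (i : ℕ) ≤ (σ i : ℕ) + 1

/-- A linear-connectivity swap network for `G` with `depth` layers of swaps.  `order t` is the order
of the vertices after the first `t` swap layers (only `t ≤ depth` is relevant); consecutive orders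
differ by a swap layer, and every edge of `G` is brought to adjacency at some time, where the time
before the first and the time after the last layer count. -/
structure SwapNetwork {V : Type*} [Fintype V] (G : SimpleGraph V) where
  /-- the number of swap layers -/
  depth : ℕ
  /-- the order of the vertices after `t` layers -/
  order : ℕ → VertexOrder V
  layer : ∀ t < depth, IsSwapLayer ((order t).symm.trans (order (t + 1)))
  adjacent : ∀ v w, G.Adj v w → ∃ t ≤ depth,
    (order t v : ℕ) + 1 = order t w ∨ (order t w : ℕ) + 1 = order t v

/-- The minimum swap depth over all linear-connectivity swap networks for `G`. -/
noncomputable def swapDepth {V : Type*} [Fintype V] (G : SimpleGraph V) : ℕ :=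
  sInf (Set.range fun S : SwapNetwork G => S.depth)

/-- The `M × N` grid graph: the graph product of two path graphs. -/
abbrev gridGraph (M N : ℕ) : SimpleGraph (Fin M × Fin N) :=
  SimpleGraph.boxProd (SimpleGraph.pathGraph M) (SimpleGraph.pathGraph N)

/-- The `2 × M × N` grid graph. -/
abbrev spinGridGraph (M N : ℕ) : SimpleGraph (Fin 2 × (Fin M × Fin N)) :=
  SimpleGraph.boxProd (SimpleGraph.pathGraph 2) (gridGraph M N)

/-! Every graph has a swap network, so that the minimum above is over a nonempty set. -/

theorem isSwapLayer_swap {n : ℕ} (i : Fin n) :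
    IsSwapLayer (Equiv.swap i.castSucc i.succ) := by
  refine ⟨fun j => Equiv.swap_apply_self _ _ j, fun j => ?_⟩
  rw [Equiv.swap_apply_def]
  split_ifs with h1 h2
  · subst h1; simp
    omega
  · subst h2; simp
    omega
  · omega

theorem swapLayer_reach {V : Type*} [Fintype V] (r r' : VertexOrder V) :
    Relation.ReflTransGen
      (fun a b : VertexOrder V => IsSwapLayer (a.symm.trans b)) r r' := by
  have key : ∀ {n : ℕ} (e : V ≃ Fin n) (σ : Equiv.Perm (Fin n)), Relation.ReflTransGen
      (fun a b : V ≃ Fin n => IsSwapLayer (a.symm.trans b)) e (e.trans σ) := by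
    intro n e σ
    cases n with
    | zero =>
      have : σ = Equiv.refl _ := Subsingleton.elim _ _
      subst this
      exact Relation.ReflTransGen.refl
    | succ n =>
      have hσ : σ ∈ Submonoid.closure
          (Set.range fun i : Fin n => Equiv.swap i.castSucc i.succ) := by
        rw [Equiv.Perm.mclosure_swap_castSucc_succ]; trivial
      induction hσ using Submonoid.closure_induction_left with
      | one => exact Relation.ReflTransGen.refl
      | mul_left x hx y _ ih =>
        obtain ⟨i, rfl⟩ := hx
        refine ih.tail ?_
        have : (e.trans y).symm.trans (e.trans (Equiv.swap i.castSucc i.succ * y))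
            = Equiv.swap i.castSucc i.succ := by
          ext j; simp
        rw [this]
        exact isSwapLayer_swap i
  have h := key r (r.symm.trans r')
  have h2 : r.trans (r.symm.trans r') = r' := by ext; simp
  rwa [h2] at h

theorem exists_swapSequence {V : Type*} [Fintype V] (r : VertexOrder V)
    (L : List (VertexOrder V)) : ∃ (d : ℕ) (o : ℕ → VertexOrder V),
      (∀ t < d, IsSwapLayer ((o t).symm.trans (o (t + 1)))) ∧ ∀ x ∈ L, ∃ t ≤ d, o t = x := by
  induction L with
  | nil => exact ⟨0, fun _ => r, by simp, by simp⟩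
  | cons x L ih =>
    obtain ⟨d, o, h1, h2⟩ := ih
    suffices H : ∃ (d' : ℕ) (o' : ℕ → VertexOrder V),
        (∀ t < d', IsSwapLayer ((o' t).symm.trans (o' (t + 1)))) ∧
        (∀ y ∈ L, ∃ t ≤ d', o' t = y) ∧ o' d' = x by
      obtain ⟨d', o', h1', h2', h3'⟩ := H
      refine ⟨d', o', h1', fun y hy => ?_⟩
      rcases List.mem_cons.1 hy with rfl | hy
      · exact ⟨d', le_rfl, h3'⟩
      · exact h2' y hy
    induction swapLayer_reach (o d) x with
    | refl => exact ⟨d, o, h1, h2, rfl⟩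
    | @tail b c _ hbc ih =>
      obtain ⟨d', o', g1, g2, g3⟩ := ih
      refine ⟨d' + 1, fun t => if t ≤ d' then o' t else c, fun t ht => ?_, fun y hy => ?_, ?_⟩
      · rcases Nat.lt_succ_iff_lt_or_eq.1 ht with h | rfl
        · simpa [h.le, Nat.succ_le_of_lt h] using g1 t h
        · simpa [g3] using hbc
      · obtain ⟨t, ht, rfl⟩ := g2 y hy
        exact ⟨t, by omega, by simp [ht]⟩
      · simp

theorem nonempty_swapNetwork {V : Type*} [Fintype V] (G : SimpleGraph V) :
    Nonempty (SwapNetwork G) := by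
  classical
  obtain ⟨d, o, h1, h2⟩ := exists_swapSequence (Fintype.equivFin V)
    (Finset.univ : Finset (VertexOrder V)).toList
  refine ⟨⟨d, o, h1, fun v w hvw => ?_⟩⟩
  have hc : 1 < Fintype.card V := Fintype.one_lt_card_iff.2 ⟨v, w, hvw.ne⟩
  let r : VertexOrder V := Fintype.equivFin V
  let r1 : VertexOrder V := r.trans (Equiv.swap (r v) ⟨0, by omega⟩)
  let r2 : VertexOrder V := r1.trans (Equiv.swap (r1 w) ⟨1, hc⟩)
  have hv1 : r1 v = ⟨0, by omega⟩ := by simp [r1]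
  have hw : r2 w = ⟨1, hc⟩ := by simp [r2]
  have hv : r2 v = ⟨0, by omega⟩ := by
    have h : r1 v ≠ r1 w := fun h => hvw.ne (r1.injective h)
    have h' : r1 v ≠ ⟨1, hc⟩ := by rw [hv1]; simp
    change Equiv.swap (r1 w) ⟨1, hc⟩ (r1 v) = _
    rw [Equiv.swap_apply_of_ne_of_ne h h', hv1]
  obtain ⟨t, ht, hot⟩ := h2 r2 (by simp)
  exact ⟨t, ht, Or.inl (by rw [hot, hv, hw])⟩

/-! The lower bounds on the 2-bandwidth are vertex-isoperimetric. If the initial segment S of an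
order has a closed radius-two neighbourhood of size at least |S| + B, some vertex of it lies at
least B positions after a vertex of S at distance at most two (`exists_near_of_card_le`). Since
every edge lies on a two-edge path, this gives 2-bandwidth at least B (`le_twoBandwidth`). It
remains to find, in each order, one segment with large gain.

That segment is the first one meeting nearly all rows or nearly all columns; exchanging the
directions, say rows. Few columns are met, so no row is close to full, and a met row gains two
vertices within itself. An unmet row has a met neighbour, whose set of columns grows by one when
copied across, so it gains two as well. This gives 2M in the plane (`gridGraph_gain`). With two
layers, one layer may have rows missing a single vertex, which gain only one; `two_layer_gain`
bounds the loss by following the row counts from such a row to an unmet one, leaving min(4M, 3M + N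
- 1) (`spinGridGraph_gain`).

The upper bounds order the vertices column by column, where edges span at most M or 2M positions;
for the 2 × M × M grid an order by diagonals saves one.

Swap depth follows from `SwapNetwork.twoBandwidth_le`: a depth d network forces 2-bandwidth at most
2d + 2, as positions move by at most one per layer. The cases N ≤ 2 not covered by this are done by
hand. -/

open Finset

/-! ### Two-neighbourhoods, initial segments and two-edge paths -/

/-- Two vertices at distance at most two. -/
def Near {V : Type*} (G : SimpleGraph V) (v w : V) : Prop :=
  v = w ∨ G.Adj v w ∨ ∃ z, G.Adj v z ∧ G.Adj z w

open Classical in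
/-- The closed neighbourhood of radius two of a set of vertices. -/
noncomputable def twoNbhd {V : Type*} [Fintype V] (G : SimpleGraph V) (S : Finset V) : Finset V :=
  univ.filter fun w => ∃ v ∈ S, Near G v w

/-- The first `t` vertices of an order. -/
def initialSet {V : Type*} [Fintype V] (r : VertexOrder V) (t : ℕ) : Finset V :=
  univ.filter fun v => (r v : ℕ) < t

theorem exists_lengthTwoLine {V : Type*} {G : SimpleGraph V} {u v w : V} (huv : G.Adj u v) (hvw : G.Adj v w)
    (huw : u ≠ w) : ∃ S ∈ lengthTwoLines G, u ∈ S.verts ∧ v ∈ S.verts ∧ w ∈ S.verts := by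
  classical
  let S : G.Subgraph := G.subgraphOfAdj huv ⊔ G.subgraphOfAdj hvw
  have hu : u ∈ S.verts := by simp [S]
  have hv : v ∈ S.verts := by simp [S]
  have hw : w ∈ S.verts := by simp [S]
  refine ⟨S, ⟨?_⟩, hu, hv, hw⟩
  let f : Fin 3 → S.verts := ![⟨u, hu⟩, ⟨v, hv⟩, ⟨w, hw⟩]
  have huv' := huv.ne
  have hvw' := hvw.ne
  have hf : Function.Bijective f := by
    constructor
    · intro i j hij
      fin_cases i <;> fin_cases j <;> simp_all [f]
    · rintro ⟨x, hx⟩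
      have hx' : x = w ∨ x = u ∨ x = v := by simpa [S] using hx
      rcases hx' with h | h | h
      · exact ⟨2, Subtype.ext h.symm⟩
      · exact ⟨0, Subtype.ext h.symm⟩
      · exact ⟨1, Subtype.ext h.symm⟩
  refine (RelIso.symm ⟨Equiv.ofBijective f hf, ?_⟩)
  intro i j
  fin_cases i <;> fin_cases j <;>
    simp [f, S, SimpleGraph.pathGraph_adj, huv', hvw', huw, huv'.symm, hvw'.symm, huw.symm]

theorem lengthTwoLines_verts {V : Type*} {G : SimpleGraph V} {S : G.Subgraph} (hS : S ∈ lengthTwoLines G) :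
    ∃ u v w, G.Adj u v ∧ G.Adj v w ∧ S.verts = {u, v, w} := by
  obtain ⟨φ⟩ := hS
  have h01 : S.coe.Adj (φ.symm 0) (φ.symm 1) := by
    rw [φ.symm.map_adj_iff]; simp [SimpleGraph.pathGraph_adj]
  have h12 : S.coe.Adj (φ.symm 1) (φ.symm 2) := by
    rw [φ.symm.map_adj_iff]; simp [SimpleGraph.pathGraph_adj]
  refine ⟨φ.symm 0, φ.symm 1, φ.symm 2, S.adj_sub h01, S.adj_sub h12, ?_⟩
  ext x
  constructor
  · intro hx
    obtain ⟨i, hi⟩ := φ.symm.surjective ⟨x, hx⟩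
    fin_cases i <;> simp_all
  · rintro (rfl | rfl | rfl) <;> exact Subtype.coe_prop _

section general
variable {V : Type*} [Fintype V]

theorem mem_twoNbhd {G : SimpleGraph V} {S : Finset V} {w : V} :
    w ∈ twoNbhd G S ↔ ∃ v ∈ S, Near G v w := by
  simp [twoNbhd]

theorem mem_initialSet {r : VertexOrder V} {t : ℕ} {v : V} :
    v ∈ initialSet r t ↔ (r v : ℕ) < t := by
  simp [initialSet]

theorem subset_twoNbhd (G : SimpleGraph V) (S : Finset V) : S ⊆ twoNbhd G S :=
  fun v hv => mem_twoNbhd.2 ⟨v, hv, Or.inl rfl⟩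

theorem twoNbhd_map {W : Type*} [Fintype W] {G : SimpleGraph V} {H : SimpleGraph W}
    (φ : G ≃g H) (S : Finset V) :
    twoNbhd H (S.map φ.toEquiv.toEmbedding) = (twoNbhd G S).map φ.toEquiv.toEmbedding := by
  ext w
  obtain ⟨w, rfl⟩ := φ.surjective w
  have hN : ∀ v, Near H (φ v) (φ w) ↔ Near G v w := by
    intro v
    simp only [Near, φ.map_adj_iff, φ.injective.eq_iff, φ.surjective.exists]
  have h2 : ∀ (T : Finset V) (x : V), φ x ∈ T.map φ.toEquiv.toEmbedding ↔ x ∈ T := by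
    intro T x
    exact Finset.mem_map' φ.toEquiv.toEmbedding
  rw [h2, mem_twoNbhd, mem_twoNbhd, φ.surjective.exists]
  simp only [h2, hN]

/-- The step at which `P` first becomes true. The gain estimates use both sides of it: the failure
of `P` before bounds the line counts, its validity after bounds the number of unmet lines. -/
theorem exists_initialSet_step [DecidableEq V] (r : VertexOrder V) (P : Finset V → Prop)
    (h0 : ¬ P ∅) (h1 : P univ) : ∃ t v, v ∉ initialSet r t ∧
      initialSet r (t + 1) = insert v (initialSet r t) ∧ ¬ P (initialSet r t) ∧
      P (initialSet r (t + 1)) := by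
  classical
  have hfull : initialSet r (Fintype.card V) = univ := by
    ext v; simp [mem_initialSet]
  have hemp : initialSet r 0 = ∅ := by
    ext v; simp [mem_initialSet]
  have hex : ∃ t, P (initialSet r t) := ⟨_, hfull ▸ h1⟩
  obtain ⟨t, ht⟩ : ∃ t, Nat.find hex = t + 1 :=
    Nat.exists_eq_succ_of_ne_zero fun h => h0 (by simpa [h, hemp] using Nat.find_spec hex)
  have hP : P (initialSet r (t + 1)) := ht ▸ Nat.find_spec hex
  have hnP : ¬ P (initialSet r t) := Nat.find_min hex (by omega)
  have hlt : t < Fintype.card V := by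
    have := Nat.find_min' hex (hfull ▸ h1)
    omega
  refine ⟨t, r.symm ⟨t, hlt⟩, by simp [mem_initialSet], ?_, hnP, hP⟩
  ext v
  rw [mem_insert, mem_initialSet, mem_initialSet, Equiv.eq_symm_apply, Fin.ext_iff]
  simp only
  omega

/-- At least `B` vertices of the neighbourhood lie outside the segment. Otherwise their distinct
positions would all fall among the `B - 1` values from `t` to `t + B - 2`. -/
theorem exists_near_of_card_le {G : SimpleGraph V} {r : VertexOrder V} {t B : ℕ} (hB : 0 < B)
    (h : (initialSet r t).card + B ≤ (twoNbhd G (initialSet r t)).card) :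
    ∃ v w, Near G v w ∧ (r v : ℕ) + B ≤ r w := by
  classical
  by_contra! hcon
  set S := initialSet r t
  have hsub : ((twoNbhd G S) \ S).image (fun v => (r v : ℕ)) ⊆ Finset.Ico t (t + B - 1) := by
    intro k hk
    obtain ⟨w, hw, rfl⟩ := Finset.mem_image.1 hk
    obtain ⟨hw1, hw2⟩ := Finset.mem_sdiff.1 hw
    obtain ⟨v, hv, hvw⟩ := mem_twoNbhd.1 hw1
    have h1 := hcon v w hvw
    have h2 := mem_initialSet.1 hv
    have h3 : ¬ (r w : ℕ) < t := fun h => hw2 (mem_initialSet.2 h)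
    rw [Finset.mem_Ico]
    omega
  have hc := Finset.card_le_card hsub
  have hinj : Function.Injective fun v => (r v : ℕ) := Fin.val_injective.comp r.injective
  rw [Finset.card_image_of_injective _ hinj, Nat.card_Ico,
    Finset.card_sdiff_of_subset (subset_twoNbhd G S)] at hc
  omega

theorem bddAbove_orderPositions (r : VertexOrder V) (W : Set V) :
    BddAbove ((fun w => (r w : ℕ)) '' W) :=
  ⟨Fintype.card V, by rintro _ ⟨w, -, rfl⟩; exact (r w).2.le⟩

theorem sub_le_orderBandwidth (r : VertexOrder V) {W : Set V} {v w : V} (hv : v ∈ W)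
    (hw : w ∈ W) : (r w : ℕ) - r v ≤ orderBandwidth r W := by
  have h1 : (r w : ℕ) ≤ sSup ((fun w => (r w : ℕ)) '' W) :=
    le_csSup (bddAbove_orderPositions r W) ⟨w, hw, rfl⟩
  have h2 : sInf ((fun w => (r w : ℕ)) '' W) ≤ r v := Nat.sInf_le ⟨v, hv, rfl⟩
  unfold orderBandwidth
  omega

theorem orderBandwidth_le (r : VertexOrder V) {W : Set V} {B : ℕ} (hne : W.Nonempty)
    (h : ∀ v ∈ W, ∀ w ∈ W, (r w : ℕ) ≤ r v + B) : orderBandwidth r W ≤ B := by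
  have hn : ((fun w => (r w : ℕ)) '' W).Nonempty := hne.image _
  obtain ⟨w, hw, h1⟩ := Nat.sSup_mem hn (bddAbove_orderPositions r W)
  obtain ⟨v, hv, h2⟩ := Nat.sInf_mem hn
  have := h v hv w hw
  simp only at h1 h2
  unfold orderBandwidth
  omega

/-- The hypothesis `hG` is needed because the far pair may be adjacent without a two-edge path
between its ends; the edge must then be extended to such a path. -/
theorem le_twoBandwidth {G : SimpleGraph V} {B : ℕ} (hB : 0 < B)
    (hG : ∀ v w, G.Adj v w → ∃ z, z ≠ v ∧ z ≠ w ∧ (G.Adj z v ∨ G.Adj w z))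
    (h : ∀ r : VertexOrder V, ∃ t,
      (initialSet r t).card + B ≤ (twoNbhd G (initialSet r t)).card) : B ≤ twoBandwidth G := by
  have : Nonempty (VertexOrder V) := ⟨Fintype.equivFin V⟩
  refine le_ciInf fun r => ?_
  obtain ⟨t, ht⟩ := h r
  obtain ⟨v, w, hvw, hd⟩ := exists_near_of_card_le hB ht
  have key : ∃ S ∈ lengthTwoLines G, v ∈ S.verts ∧ w ∈ S.verts := by
    rcases hvw with rfl | hvw | ⟨z, hvz, hzw⟩
    · omega
    · obtain ⟨z, hzv, hzw, hz | hz⟩ := hG v w hvw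
      · obtain ⟨S, hS, _, h1, h2⟩ := exists_lengthTwoLine hz hvw hzw
        exact ⟨S, hS, h1, h2⟩
      · obtain ⟨S, hS, h1, h2, _⟩ := exists_lengthTwoLine hvw hz hzv.symm
        exact ⟨S, hS, h1, h2⟩
    · obtain ⟨S, hS, h1, _, h2⟩ := exists_lengthTwoLine hvz hzw (by rintro rfl; omega)
      exact ⟨S, hS, h1, h2⟩
  obtain ⟨S, hS, hv, hw⟩ := key
  have h1 := sub_le_orderBandwidth r hv hw
  have hbdd : BddAbove (Set.range fun S : lengthTwoLines G => orderBandwidth r S.1.verts) := by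
    refine ⟨Fintype.card V, ?_⟩
    rintro _ ⟨T, rfl⟩
    obtain ⟨a, b, c, -, -, hT⟩ := lengthTwoLines_verts T.2
    exact orderBandwidth_le r (by simp [hT]) fun x _ y _ => by
      have := (r y).2
      omega
  have h2 := le_ciSup hbdd ⟨S, hS⟩
  simp only at h2
  omega

theorem twoBandwidth_le_of_order {G : SimpleGraph V} {B : ℕ} (r : VertexOrder V)
    (h : ∀ v w, Near G v w → (r w : ℕ) ≤ r v + B) : twoBandwidth G ≤ B := by
  refine (ciInf_le (OrderBot.bddBelow _) r).trans ?_
  refine ciSup_le' fun S => ?_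
  obtain ⟨u, v, w, huv, hvw, hS⟩ := lengthTwoLines_verts S.2
  refine orderBandwidth_le r (by simp [hS]) fun x hx y hy => h x y ?_
  rw [hS] at hx hy
  rcases hx with rfl | rfl | rfl <;> rcases hy with rfl | rfl | rfl
  · exact Or.inl rfl
  · exact Or.inr (Or.inl huv)
  · exact Or.inr (Or.inr ⟨_, huv, hvw⟩)
  · exact Or.inr (Or.inl huv.symm)
  · exact Or.inl rfl
  · exact Or.inr (Or.inl hvw)
  · exact Or.inr (Or.inr ⟨_, hvw.symm, huv.symm⟩)
  · exact Or.inr (Or.inl hvw.symm)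
  · exact Or.inl rfl

/-! ### Upper bounds from injective keys -/

/-- The order sorting the vertices by an injective key. -/
theorem exists_order_of_injective {key : V → ℕ} (hk : Function.Injective key) :
    ∃ r : VertexOrder V, ∀ v, (r v : ℕ) = (univ.filter fun u => key u < key v).card := by
  classical
  let f : V → Fin (Fintype.card V) := fun v =>
    ⟨(univ.filter fun u => key u < key v).card, by
      refine Finset.card_lt_univ_of_notMem (x := v) ?_
      simp⟩
  have hmono : ∀ v w, key v < key w → f v < f w := by
    intro v w hvw
    refine Finset.card_lt_card (Finset.ssubset_iff_of_subset ?_ |>.2 ⟨v, by simpa using hvw, by simp⟩)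
    intro u hu
    simp only [Finset.mem_filter, Finset.mem_univ, true_and] at hu ⊢
    omega
  have hinj : Function.Injective f := by
    intro v w hvw
    rcases lt_trichotomy (key v) (key w) with h | h | h
    · exact absurd hvw (hmono v w h).ne
    · exact hk h
    · exact absurd hvw (hmono w v h).ne'
  refine ⟨Equiv.ofBijective f ((Fintype.bijective_iff_injective_and_card f).2 ⟨hinj, by simp⟩), ?_⟩
  intro v
  rfl

/-- Positions differ by the number of keys in between. Counting vertices instead of subtracting keys
allows keys with gaps, such as the diagonal one. -/
theorem twoBandwidth_le_of_key {G : SimpleGraph V} {B : ℕ} {key : V → ℕ}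
    (hk : Function.Injective key)
    (h : ∀ v w, Near G v w → key v < key w →
      (univ.filter fun u => key v ≤ key u ∧ key u < key w).card ≤ B) : twoBandwidth G ≤ B := by
  classical
  obtain ⟨r, hr⟩ := exists_order_of_injective hk
  refine twoBandwidth_le_of_order r fun v w hvw => ?_
  rw [hr, hr]
  rcases lt_or_ge (key v) (key w) with hlt | hge
  · refine le_trans ?_ (Nat.add_le_add_left (h v w hvw hlt) _)
    rw [← Finset.card_union_of_disjoint]
    · refine Finset.card_le_card fun u hu => ?_
      simp only [Finset.mem_union, Finset.mem_filter, Finset.mem_univ, true_and] at hu ⊢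
      omega
    · rw [Finset.disjoint_left]
      intro u
      simp only [Finset.mem_filter, Finset.mem_univ, true_and]
      omega
  · refine le_trans (Finset.card_le_card fun u hu => ?_) (Nat.le_add_right _ _)
    simp only [Finset.mem_filter, Finset.mem_univ, true_and] at hu ⊢
    omega

theorem card_key_Ico_le {key : V → ℕ} (hk : Function.Injective key) (a b : ℕ) :
    (univ.filter fun u => a ≤ key u ∧ key u < b).card ≤ b - a := by
  rw [← Nat.card_Ico, ← Finset.card_image_of_injective _ hk]
  refine Finset.card_le_card fun x hx => ?_
  simp only [Finset.mem_image, Finset.mem_filter, Finset.mem_univ, true_and] at hx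
  obtain ⟨u, hu, rfl⟩ := hx
  simpa using hu

/-- If an injective key changes by at most `b` along edges, the 2-bandwidth is at most `2 * b`. -/
theorem twoBandwidth_le_two_mul {G : SimpleGraph V} {b : ℕ} {key : V → ℕ}
    (hk : Function.Injective key) (h : ∀ v w, G.Adj v w → key w ≤ key v + b) :
    twoBandwidth G ≤ 2 * b := by
  refine twoBandwidth_le_of_key hk fun v w hvw _ => (card_key_Ico_le hk _ _).trans ?_
  rcases hvw with rfl | hvw | ⟨z, hvz, hzw⟩
  · omega
  · have := h v w hvw
    omega
  · have := h v z hvz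
    have := h z w hzw
    omega

/-! ### Swap networks and the 2-bandwidth -/

/-- Positions change by at most one per layer. -/
theorem SwapNetwork.order_le {G : SimpleGraph V} (N : SwapNetwork G) (v : V) {s t : ℕ}
    (hst : s ≤ t) (ht : t ≤ N.depth) :
    (N.order t v : ℕ) ≤ N.order s v + (t - s) ∧ (N.order s v : ℕ) ≤ N.order t v + (t - s) := by
  induction t, hst using Nat.le_induction with
  | base => simp
  | succ t hst ih =>
    have h1 := ih (by omega)
    have h2 := (N.layer t (by omega)).2 (N.order t v)
    simp only [Equiv.trans_apply, Equiv.symm_apply_apply] at h2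
    omega

/-- Let the edges at the middle vertex z be realised at times s ≤ t. In the initial order the ends
are then at most (s + 1) + (t - s) + (t + 1) = 2t + 2 apart, the middle term being the drift of z
between the two times. -/
theorem SwapNetwork.twoBandwidth_le {G : SimpleGraph V} (N : SwapNetwork G) :
    twoBandwidth G ≤ 2 * N.depth + 2 := by
  refine twoBandwidth_le_of_order (N.order 0) fun v w hvw => ?_
  have h0 : ∀ x t, t ≤ N.depth → _ := fun x t ht => N.order_le x (Nat.zero_le t) ht
  rcases hvw with rfl | hvw | ⟨z, hvz, hzw⟩
  · omega
  · obtain ⟨t, ht, h⟩ := N.adjacent v w hvw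
    have := h0 v t ht
    have := h0 w t ht
    omega
  · obtain ⟨t, ht, h⟩ := N.adjacent v z hvz
    obtain ⟨s, hs, h'⟩ := N.adjacent z w hzw
    have := h0 v t ht
    have := h0 w s hs
    rcases le_total s t with hst | hst
    · have := N.order_le z hst ht
      omega
    · have := N.order_le z hst hs
      omega

theorem le_swapDepth {G : SimpleGraph V} {d : ℕ} (h : ∀ N : SwapNetwork G, d ≤ N.depth) :
    d ≤ swapDepth G := by
  obtain ⟨N⟩ := nonempty_swapNetwork G
  exact le_csInf ⟨_, N, rfl⟩ (by rintro _ ⟨N, rfl⟩; exact h N)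

end general

/-! ### Lines -/

theorem exists_boundary_step {n : ℕ} {A : Finset (Fin n)} (hA : A.Nonempty) (hA' : A ≠ univ) :
    ∃ i ∈ A, ∃ j ∉ A, (i : ℕ) + 1 = j ∨ (j : ℕ) + 1 = i := by
  by_contra! hcon
  obtain ⟨x, hx⟩ := hA
  refine hA' (Finset.eq_univ_iff_forall.2 fun y => ?_)
  have up : ∀ d (z : Fin n), (z : ℕ) = x + d → z ∈ A := by
    intro d
    induction d with
    | zero => intro z hz; rwa [show z = x from Fin.ext (by simpa using hz)]
    | succ d ih =>
      intro z hz
      by_contra hzA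
      have := z.2
      exact (hcon ⟨x + d, by omega⟩ (ih _ rfl) z hzA).1 (by simp; omega)
  have down : ∀ d (z : Fin n), (x : ℕ) = z + d → z ∈ A := by
    intro d
    induction d with
    | zero => intro z hz; rwa [show z = x from Fin.ext (by simpa using hz.symm)]
    | succ d ih =>
      intro z hz
      by_contra hzA
      have := x.2
      exact (hcon ⟨z + 1, by omega⟩ (ih _ (by simp; omega)) z hzA).2 (by simp)
  rcases le_total (x : ℕ) y with h | h
  · exact up (y - x) y (by omega)
  · exact down (x - y) y (by omega)

theorem card_add_one_le_of_step {n : ℕ} {A K : Finset (Fin n)} (hA : A.Nonempty) (hAK : A ⊆ K)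
    (h : ∀ i ∈ A, ∀ j : Fin n, ((i : ℕ) + 1 = j ∨ (j : ℕ) + 1 = i) → j ∈ K) :
    min n (A.card + 1) ≤ K.card := by
  classical
  by_cases hA' : A = univ
  · have := Finset.card_le_card hAK
    simp [hA'] at this ⊢
    omega
  · obtain ⟨i, hi, j, hj, hij⟩ := exists_boundary_step hA hA'
    have : (insert j A).card ≤ K.card :=
      Finset.card_le_card (Finset.insert_subset (h i hi j hij) hAK)
    rw [Finset.card_insert_of_notMem hj] at this
    omega

/-- The number of vertices of `S` on the line `f`. -/
def lineCount {V : Type*} [DecidableEq V] {n : ℕ} (f : Fin n → V) (S : Finset V) : ℕ :=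
  (univ.filter fun j => f j ∈ S).card

section lines
variable {V : Type*} [Fintype V] [DecidableEq V] {G : SimpleGraph V} {n : ℕ} {f f' : Fin n → V}
  {S : Finset V}

theorem lineCount_add_one_le (hf : ∀ i j : Fin n, (i : ℕ) + 1 = j → G.Adj (f i) (f j))
    (hff : ∀ j, G.Adj (f j) (f' j)) (h0 : 0 < lineCount f S) :
    min n (lineCount f S + 1) ≤ lineCount f' (twoNbhd G S) := by
  refine card_add_one_le_of_step (Finset.card_pos.1 h0) ?_ ?_
  · intro j hj
    simp only [Finset.mem_filter, Finset.mem_univ, true_and] at hj ⊢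
    exact mem_twoNbhd.2 ⟨_, hj, Or.inr (Or.inl (hff j))⟩
  · intro i hi j hij
    simp only [Finset.mem_filter, Finset.mem_univ, true_and] at hi ⊢
    refine mem_twoNbhd.2 ⟨_, hi, Or.inr (Or.inr ⟨f j, ?_, hff j⟩)⟩
    rcases hij with h | h
    · exact hf _ _ h
    · exact (hf _ _ h).symm

/-- A nonempty proper subset of a path grows under taking neighbours; this is applied twice, through
the intermediate set `A1`. -/
theorem lineCount_add_two_le (hf : ∀ i j : Fin n, (i : ℕ) + 1 = j → G.Adj (f i) (f j))
    (h0 : 0 < lineCount f S) :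
    min n (lineCount f S + 2) ≤ lineCount f (twoNbhd G S) := by
  classical
  have hf' : ∀ i j : Fin n, ((i : ℕ) + 1 = j ∨ (j : ℕ) + 1 = i) → G.Adj (f i) (f j) := by
    rintro i j (h | h)
    · exact hf _ _ h
    · exact (hf _ _ h).symm
  set A := univ.filter fun j => f j ∈ S with hA
  let A1 : Finset (Fin n) := univ.filter fun j =>
    j ∈ A ∨ ∃ i ∈ A, ((i : ℕ) + 1 = j ∨ (j : ℕ) + 1 = i)
  have hne : A.Nonempty := Finset.card_pos.1 h0
  have hAA : A ⊆ A1 := fun j hj => by simp [A1, hj]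
  have h1 : min n (A.card + 1) ≤ A1.card :=
    card_add_one_le_of_step hne hAA fun i hi j hij => by
      simp only [A1, Finset.mem_filter, Finset.mem_univ, true_and]
      exact Or.inr ⟨i, hi, hij⟩
  have h2 : min n (A1.card + 1) ≤ lineCount f (twoNbhd G S) := by
    refine card_add_one_le_of_step (hne.mono hAA) ?_ ?_
    · intro j hj
      simp only [A1, hA, Finset.mem_filter, Finset.mem_univ, true_and] at hj ⊢
      rcases hj with hj | ⟨i, hi, hij⟩
      · exact subset_twoNbhd _ _ hj
      · exact mem_twoNbhd.2 ⟨_, hi, Or.inr (Or.inl (hf' _ _ hij))⟩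
    · intro k hk j hkj
      simp only [A1, hA, Finset.mem_filter, Finset.mem_univ, true_and] at hk ⊢
      rcases hk with hk | ⟨i, hi, hik⟩
      · exact mem_twoNbhd.2 ⟨_, hk, Or.inr (Or.inl (hf' _ _ hkj))⟩
      · exact mem_twoNbhd.2 ⟨_, hi, Or.inr (Or.inr ⟨_, hf' _ _ hik, hf' _ _ hkj⟩)⟩
  have h3 : lineCount f S = A.card := rfl
  omega

theorem lineCount_le_of_near (hff : ∀ j, Near G (f j) (f' j)) :
    lineCount f S ≤ lineCount f' (twoNbhd G S) := by
  refine Finset.card_le_card fun j hj => ?_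
  simp only [Finset.mem_filter, Finset.mem_univ, true_and] at hj ⊢
  exact mem_twoNbhd.2 ⟨_, hj, hff j⟩

end lines

/-! ### Arithmetic of the gain of two layers -/

/-- `J` is the path from `x` (excluded) to `y` (included). Each step from i to j gives g j - a j ≥ 1
+ a i - a j, and these telescope. The distance clause records that `y` is the only point of `J`
farthest from `x`. -/
theorem exists_telescoping_finset {A : ℕ} (a g : Fin A → ℤ)
    (hstep : ∀ i j : Fin A, ((i : ℕ) + 1 = j ∨ (j : ℕ) + 1 = i) → a i + 1 ≤ g j) (x : Fin A) :
    ∀ (m : ℕ) (y : Fin A), Nat.dist x y = m → ∃ J : Finset (Fin A),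
      (∀ i ∈ J, Nat.dist x i ≤ m ∧ (Nat.dist x i = m → i = y)) ∧
      J.card + a x - a y ≤ ∑ i ∈ J, (g i - a i) := by
  intro m
  induction m with
  | zero =>
    intro y hy
    obtain rfl : x = y := Fin.ext (Nat.eq_of_dist_eq_zero hy)
    exact ⟨∅, by simp, by simp⟩
  | succ m ih =>
    intro y hy
    obtain ⟨z, hz, hzy⟩ : ∃ z : Fin A, Nat.dist x z = m ∧
        ((z : ℕ) + 1 = y ∨ (y : ℕ) + 1 = z) := by
      have := y.2
      simp only [Nat.dist] at hy ⊢
      rcases lt_or_ge (x : ℕ) y with h | h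
      · exact ⟨⟨y - 1, by omega⟩, by simp only; omega, by simp only; omega⟩
      · exact ⟨⟨y + 1, by omega⟩, by simp only; omega, Or.inr rfl⟩
    obtain ⟨J, hJ, hsum⟩ := ih z hz
    have hyJ : y ∉ J := fun h => by
      have := (hJ y h).1
      omega
    refine ⟨insert y J, ?_, ?_⟩
    · intro i hi
      rcases Finset.mem_insert.1 hi with rfl | hi
      · exact ⟨hy.le, fun _ => rfl⟩
      · have := (hJ i hi).1
        exact ⟨by omega, fun h => by omega⟩
    · rw [Finset.card_insert_of_notMem hyJ, Finset.sum_insert hyJ]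
      have := hstep z y hzy
      push_cast
      linarith

theorem card_mul_le_sum_sub {ι : Type*} (s : Finset ι) (e : ι → ℤ) (k : ℤ) (h : ∀ i, k ≤ e i) :
    s.card * k ≤ ∑ i ∈ s, e i := by
  simpa using Finset.card_nsmul_le_sum s e k fun i _ => h i

/-- The gain of two layers of `A` lines of length `B`, with `a₀`, `a₁` vertices before and `g₀`,
`g₁` after enlarging, when the first layer has no full line. -/
theorem two_layer_gain {A B : ℕ} (hA : 2 ≤ A) (hB : 3 ≤ B) (a₀ a₁ g₀ g₁ : Fin A → ℤ)
    (ha₀ : ∀ i, 0 ≤ a₀ i ∧ a₀ i ≤ B - 1) (ha₁ : ∀ i, 0 ≤ a₁ i ∧ a₁ i ≤ B - 2)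
    (h₀ : ∀ i, 0 < a₀ i → min (B : ℤ) (a₀ i + 2) ≤ g₀ i)
    (h₁ : ∀ i, 0 < a₁ i → min (B : ℤ) (a₁ i + 2) ≤ g₁ i)
    (h₀₁ : ∀ i, 0 < a₀ i → min (B : ℤ) (a₀ i + 1) ≤ g₁ i)
    (h₁₀ : ∀ i, 0 < a₁ i → min (B : ℤ) (a₁ i + 1) ≤ g₀ i)
    (s₀ : ∀ i j : Fin A, ((i : ℕ) + 1 = j ∨ (j : ℕ) + 1 = i) → 0 < a₀ i →
      min (B : ℤ) (a₀ i + 1) ≤ g₀ j)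
    (s₁ : ∀ i j : Fin A, ((i : ℕ) + 1 = j ∨ (j : ℕ) + 1 = i) → 0 < a₁ i →
      min (B : ℤ) (a₁ i + 1) ≤ g₁ j)
    (Z₀ Z₁ : Finset (Fin A)) (hZ₀ : ∀ i, i ∈ Z₀ ↔ a₀ i = 0) (hZ₁ : ∀ i, i ∈ Z₁ ↔ a₁ i = 0)
    (hZ : 2 ≤ Z₀.card + Z₁.card)
    (hZ' : Z₀.card + Z₁.card ≤ 2 ∨ Z₀.card = 0 ∨ Z₁.card = 0) :
    min (4 * (A : ℤ)) (3 * A + B - 1) ≤ ∑ i, (g₀ i - a₀ i) + ∑ i, (g₁ i - a₁ i) := by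
  have hB' : (3 : ℤ) ≤ B := by exact_mod_cast hB
  have nbr : ∀ i : Fin A, ∃ j : Fin A, (j : ℕ) + 1 = i ∨ (i : ℕ) + 1 = j := by
    intro i
    have := i.2
    by_cases h : (i : ℕ) = 0
    · exact ⟨⟨1, by omega⟩, by simp; omega⟩
    · exact ⟨⟨i - 1, by omega⟩, by simp; omega⟩
  -- If line `i` is unmet in both layers, `hZ'` leaves no other unmet line, so the neighbouring
  -- lines are met in both.
  have unmet : ∀ i j : Fin A, ((j : ℕ) + 1 = i ∨ (i : ℕ) + 1 = j) → a₀ i = 0 → a₁ i = 0 →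
      0 < a₀ j ∧ 0 < a₁ j := by
    intro i j hij h0 h1
    have hi0 := (hZ₀ i).2 h0
    have hi1 := (hZ₁ i).2 h1
    have hc0 := Finset.card_pos.2 ⟨i, hi0⟩
    have hc1 := Finset.card_pos.2 ⟨i, hi1⟩
    have hne : j ≠ i := by rintro rfl; omega
    have hj0 : j ∉ Z₀ := fun hj => hne (Finset.card_le_one.1 (by omega) j hj i hi0)
    have hj1 : j ∉ Z₁ := fun hj => hne (Finset.card_le_one.1 (by omega) j hj i hi1)
    rw [hZ₀] at hj0
    rw [hZ₁] at hj1
    have := (ha₀ j).1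
    have := (ha₁ j).1
    omega
  have e₁ : ∀ i, 2 ≤ g₁ i - a₁ i := by
    intro i
    have hi1 := ha₁ i
    rcases hi1.1.eq_or_lt with hz | hp
    · rcases (ha₀ i).1.eq_or_lt with hz' | hp'
      · obtain ⟨j, hj⟩ := nbr i
        have h := (unmet i j hj hz'.symm hz.symm).2
        have := s₁ j i hj h
        omega
      · have := h₀₁ i hp'
        omega
    · have := h₁ i hp
      omega
  have e₀ : ∀ i, a₀ i ≤ B - 2 → 2 ≤ g₀ i - a₀ i := by
    intro i hi
    rcases (ha₀ i).1.eq_or_lt with hz | hp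
    · rcases (ha₁ i).1.eq_or_lt with hz' | hp'
      · obtain ⟨j, hj⟩ := nbr i
        have h := (unmet i j hj hz.symm hz'.symm).1
        have := s₀ j i hj h
        omega
      · have := h₁₀ i hp'
        omega
    · have := h₀ i hp
      omega
  have e₀' : ∀ i, 1 ≤ g₀ i - a₀ i := by
    intro i
    have hi := ha₀ i
    by_cases h : a₀ i ≤ B - 2
    · have := e₀ i h
      omega
    · have := h₀ i (by omega)
      omega
  have S₁ := card_mul_le_sum_sub univ (fun i => g₁ i - a₁ i) 2 e₁
  simp only [Finset.card_univ, Fintype.card_fin] at S₁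
  -- A line gains only one when its count is `B - 1`, which can happen in the first layer only.
  -- Without such a line the total gain is at least 4A.
  by_cases hx : ∀ i, a₀ i ≤ B - 2
  · have S₀ := card_mul_le_sum_sub univ (fun i => g₀ i - a₀ i) 2 fun i => e₀ i (hx i)
    simp only [Finset.card_univ, Fintype.card_fin] at S₀
    refine (min_le_left _ _).trans ?_
    linarith
  · push Not at hx
    obtain ⟨x, hx⟩ := hx
    have hax : a₀ x = B - 1 := by have := (ha₀ x).2; omega
    refine (min_le_right _ _).trans ?_
    have hstep : ∀ i j : Fin A, ((i : ℕ) + 1 = j ∨ (j : ℕ) + 1 = i) → a₀ i + 1 ≤ g₀ j := by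
      intro i j hij
      rcases (ha₀ i).1.eq_or_lt with hz | hp
      · have := e₀' j
        have := (ha₀ j).1
        omega
      · have := s₀ i j hij hp
        have := (ha₀ i).2
        omega
    have hT := exists_telescoping_finset a₀ g₀ hstep x
    have split : ∀ J : Finset (Fin A), ∑ i, (g₀ i - a₀ i) =
        ∑ i ∈ J, (g₀ i - a₀ i) + ∑ i ∈ Jᶜ, (g₀ i - a₀ i) := fun J =>
      (Finset.sum_add_sum_compl J _).symm
    have hcompl : ∀ J : Finset (Fin A), (J.card : ℤ) + (Jᶜ.card : ℤ) = A := by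
      intro J
      have := Finset.card_add_card_compl J
      rw [Fintype.card_fin] at this
      exact_mod_cast this
    by_cases hZe : Z₀.card = 0
    -- All unmet lines are in the second layer. Stopping the path at the one nearest `x`, `y`, the
    -- telescoped sum loses `a₀ y`, but line `y` of the second layer gains at least `a₀ y + 1`. This
    -- is still one short of the bound.
    · have hZ2 : 1 < Z₁.card := by omega
      obtain ⟨y, hy, hmin⟩ := Finset.exists_min_image Z₁ (fun i => Nat.dist x i)
        (Finset.card_pos.1 (by omega))
      obtain ⟨y', hy', hne⟩ := Finset.exists_mem_ne hZ2 y
      obtain ⟨J, hJ, hsum⟩ := hT _ y rfl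
      have hyJ : y' ∉ J := fun h => hne ((hJ y' h).2 (le_antisymm (hJ y' h).1 (hmin y' hy')))
      rw [hZ₁] at hy hy'
      have hpos : ∀ i, 0 < a₀ i := by
        intro i
        have hi : i ∉ Z₀ := by rw [Finset.card_eq_zero.1 hZe]; simp
        rw [hZ₀] at hi
        have := (ha₀ i).1
        omega
      have gy := h₀₁ y (hpos y)
      have gy' := h₀₁ y' (hpos y')
      have ay := ha₀ y
      have ay' := ha₀ y'
      -- The missing unit: the second unmet line `y'` is off the path, and there the two layers gain
      -- 4 together instead of the generic 1 + 2.
      have pair : 4 ≤ (g₀ y' - a₀ y') + (g₁ y' - a₁ y') := by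
        have := e₀' y'
        have := e₁ y'
        by_cases h : a₀ y' ≤ B - 2
        · have := e₀ y' h
          omega
        · omega
      have hJc : y' ∈ Jᶜ := Finset.mem_compl.2 hyJ
      have S₀ := Finset.add_sum_erase Jᶜ (fun i => g₀ i - a₀ i) hJc
      have S₀' := card_mul_le_sum_sub (Jᶜ.erase y') (fun i => g₀ i - a₀ i) 1 e₀'
      rw [Finset.card_erase_of_mem hJc, Nat.cast_sub (Finset.card_pos.2 ⟨_, hJc⟩)] at S₀'
      have T₀ := Finset.add_sum_erase univ (fun i => g₁ i - a₁ i) (Finset.mem_univ y)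
      have hm : y' ∈ univ.erase y := Finset.mem_erase.2 ⟨hne, Finset.mem_univ _⟩
      have T₁ := Finset.add_sum_erase (univ.erase y) (fun i => g₁ i - a₁ i) hm
      have T₂ := card_mul_le_sum_sub ((univ.erase y).erase y') (fun i => g₁ i - a₁ i) 2 e₁
      rw [Finset.card_erase_of_mem hm, Finset.card_erase_of_mem (Finset.mem_univ _),
        Finset.card_univ, Fintype.card_fin, Nat.cast_sub (by omega), Nat.cast_sub (by omega)] at T₂
      have := split J
      have := hcompl J
      push_cast at *
      have : a₀ y + 1 ≤ g₁ y := by omega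
      linarith
    -- Here the path ends at an unmet line of the first layer, so telescoping yields the full
    -- surplus `B - 1`.
    · obtain ⟨y, hy⟩ := Finset.card_pos.1 (Nat.pos_of_ne_zero hZe)
      rw [hZ₀] at hy
      obtain ⟨J, -, hsum⟩ := hT _ y rfl
      have := split J
      have := hcompl J
      have S₀ := card_mul_le_sum_sub Jᶜ (fun i => g₀ i - a₀ i) 1 e₀'
      linarith

/-! ### Counting on lines of a grid -/

section count
variable {V : Type*} [DecidableEq V] {n : ℕ} {f : Fin n → V} {S : Finset V}

theorem lineCount_pos_iff : 0 < lineCount f S ↔ ∃ j, f j ∈ S := by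
  rw [lineCount, Finset.card_pos]
  simp [Finset.Nonempty]

theorem lineCount_insert_le (hf : Function.Injective f) (v : V) :
    lineCount f (insert v S) ≤ lineCount f S + 1 := by
  classical
  have h : (univ.filter fun j => f j ∈ insert v S) ⊆
      (univ.filter fun j => f j = v) ∪ univ.filter fun j => f j ∈ S := by
    intro j
    simp
  refine (Finset.card_le_card h).trans ((Finset.card_union_le _ _).trans ?_)
  have h1 : (univ.filter fun j => f j = v).card ≤ 1 :=
    Finset.card_le_one.2 fun a ha b hb => by
      simp only [Finset.mem_filter, Finset.mem_univ, true_and] at ha hb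
      exact hf (ha.trans hb.symm)
  unfold lineCount
  omega

theorem lineCount_insert_of_notMem {v : V} (hv : ∀ j, f j ≠ v) :
    lineCount f (insert v S) = lineCount f S := by
  simp [lineCount, hv]

end count

section grid
variable {A B : ℕ}

theorem lineCount_le_card_image_snd (T : Finset (Fin A × Fin B)) (i : Fin A) :
    lineCount (fun j => (i, j)) T ≤ (T.image Prod.snd).card :=
  Finset.card_le_card fun j hj => by
    simp only [Finset.mem_filter, Finset.mem_univ, true_and] at hj
    exact Finset.mem_image.2 ⟨_, hj, rfl⟩

theorem lineCount_pos_iff_mem_image_fst (T : Finset (Fin A × Fin B)) (i : Fin A) :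
    0 < lineCount (fun j => (i, j)) T ↔ i ∈ T.image Prod.fst := by
  rw [lineCount_pos_iff]
  simp

theorem card_eq_sum_lineCount (T : Finset (Fin A × Fin B)) :
    T.card = ∑ i, lineCount (fun j => (i, j)) T := by
  have h : T = univ.filter (· ∈ T) := by simp
  conv_lhs => rw [h, Finset.card_filter, Fintype.sum_prod_type]
  simp only [lineCount, Finset.card_filter]

/-- A vertex opening a new row leaves the other rows unchanged, so the column bound from before the
insertion survives. -/
theorem lineCount_insert_le_of_notMem_image {T : Finset (Fin A × Fin B)} {v : Fin A × Fin B}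
    (hv : v.1 ∉ T.image Prod.fst) (i : Fin A) :
    lineCount (fun j => (i, j)) (insert v T) ≤ max 1 (T.image Prod.snd).card := by
  have h2 := lineCount_le_card_image_snd T i
  by_cases hi : i ∈ T.image Prod.fst
  · have : lineCount (fun j => (i, j)) (insert v T) = lineCount (fun j => (i, j)) T :=
      lineCount_insert_of_notMem fun j hj => hv (by rw [← hj]; exact hi)
    omega
  · have h1 := lineCount_insert_le (f := fun j : Fin B => (i, j)) (S := T)
      (fun a b h => (Prod.mk.inj h).2) v
    rw [← lineCount_pos_iff_mem_image_fst] at hi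
    omega

/-- The part of a set of vertices in one layer. -/
def layer (S : Finset (Fin 2 × (Fin A × Fin B))) (l : Fin 2) : Finset (Fin A × Fin B) :=
  univ.filter fun p => (l, p) ∈ S

theorem mem_layer {S : Finset (Fin 2 × (Fin A × Fin B))} {l : Fin 2} {p : Fin A × Fin B} :
    p ∈ layer S l ↔ (l, p) ∈ S := by
  simp [layer]

theorem layer_insert_same (S : Finset (Fin 2 × (Fin A × Fin B))) (l : Fin 2)
    (p : Fin A × Fin B) : layer (insert (l, p) S) l = insert p (layer S l) := by
  ext q; simp [mem_layer]

theorem layer_insert_of_ne (S : Finset (Fin 2 × (Fin A × Fin B))) {l k : Fin 2} (h : k ≠ l)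
    (p : Fin A × Fin B) : layer (insert (l, p) S) k = layer S k := by
  ext q; simp [mem_layer, h]

theorem lineCount_layer (S : Finset (Fin 2 × (Fin A × Fin B))) (l : Fin 2) (i : Fin A) :
    lineCount (fun j => (i, j)) (layer S l) = lineCount (fun j => (l, (i, j))) S := by
  simp [lineCount, mem_layer]

theorem card_eq_card_layer_add (S : Finset (Fin 2 × (Fin A × Fin B))) (l : Fin 2) :
    S.card = (layer S l).card + (layer S (1 - l)).card := by
  have h : S = univ.filter (· ∈ S) := by simp
  conv_lhs => rw [h, Finset.card_filter, Fintype.sum_prod_type, Fin.sum_univ_two]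
  simp only [layer, Finset.card_filter]
  fin_cases l
  · rfl
  · exact add_comm _ _

theorem gridGraph_adj_row (i : Fin A) (j j' : Fin B) (h : (j : ℕ) + 1 = j') :
    (gridGraph A B).Adj (i, j) (i, j') := by
  simp [SimpleGraph.boxProd_adj, SimpleGraph.pathGraph_adj, h]

theorem gridGraph_adj_col {i i' : Fin A} (h : (i : ℕ) + 1 = i' ∨ (i' : ℕ) + 1 = i)
    (j : Fin B) : (gridGraph A B).Adj (i, j) (i', j) := by
  simp [SimpleGraph.boxProd_adj, SimpleGraph.pathGraph_adj, h]

theorem spinGridGraph_adj_layer {l : Fin 2} {p q : Fin A × Fin B} (h : (gridGraph A B).Adj p q) :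
    (spinGridGraph A B).Adj (l, p) (l, q) := by
  rw [SimpleGraph.boxProd_adj]
  exact Or.inr ⟨h, rfl⟩

theorem spinGridGraph_adj_cross {l k : Fin 2} (h : l ≠ k) (p : Fin A × Fin B) :
    (spinGridGraph A B).Adj (l, p) (k, p) := by
  rw [SimpleGraph.boxProd_adj]
  refine Or.inl ⟨?_, rfl⟩
  rw [SimpleGraph.pathGraph_adj]
  simp only
  omega

/-- The new vertex opens row number `A - 1`, so exactly one row is unmet and its neighbours are met;
every row holds at most `B - 2` vertices. Hence each of the `A` rows gains two. -/
theorem gridGraph_gain (hA : 2 ≤ A) (hB : 3 ≤ B) {S : Finset (Fin A × Fin B)} {v : Fin A × Fin B}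
    (hr : (S.image Prod.fst).card < A - 1) (hc : (S.image Prod.snd).card < B - 1)
    (hr' : A - 1 ≤ ((insert v S).image Prod.fst).card) :
    (insert v S).card + 2 * A ≤ (twoNbhd (gridGraph A B) (insert v S)).card := by
  have hv : v.1 ∉ S.image Prod.fst := by
    intro h
    rw [Finset.image_insert, Finset.insert_eq_of_mem h] at hr'
    omega
  have hcard : ((insert v S).image Prod.fst).card ≤ A - 1 := by
    rw [Finset.image_insert]
    exact (Finset.card_insert_le _ _).trans (by omega)
  have ha := lineCount_insert_le_of_notMem_image hv
  set T := insert v S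
  have key : ∀ i, lineCount (fun j => (i, j)) T + 2 ≤
      lineCount (fun j => (i, j)) (twoNbhd (gridGraph A B) T) := by
    intro i
    have hai := ha i
    by_cases hi : 0 < lineCount (fun j => (i, j)) T
    · have := lineCount_add_two_le (G := gridGraph A B) (f := fun j => (i, j)) (gridGraph_adj_row i) hi
      omega
    · obtain ⟨k, hk⟩ : ∃ k : Fin A, (k : ℕ) + 1 = i ∨ (i : ℕ) + 1 = k := by
        have := i.2
        by_cases h : (i : ℕ) = 0
        · exact ⟨⟨1, by omega⟩, by simp; omega⟩
        · exact ⟨⟨i - 1, by omega⟩, by simp; omega⟩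
      have hki : 0 < lineCount (fun j => (k, j)) T := by
        rw [lineCount_pos_iff_mem_image_fst] at hi ⊢
        by_contra hk'
        have hsub : insert k (insert i (T.image Prod.fst)) ⊆ univ := Finset.subset_univ _
        have hc' := Finset.card_le_card hsub
        have hne : k ≠ i := by rintro rfl; omega
        rw [Finset.card_insert_of_notMem (by simp only [Finset.mem_insert]; tauto),
          Finset.card_insert_of_notMem hi, Finset.card_univ, Fintype.card_fin] at hc'
        omega
      have := lineCount_add_one_le (G := gridGraph A B) (f := fun j => (k, j)) (f' := fun j => (i, j))
        (gridGraph_adj_row k) (gridGraph_adj_col hk) hki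
      omega
  rw [card_eq_sum_lineCount T, card_eq_sum_lineCount (twoNbhd _ T)]
  calc _ = ∑ i : Fin A, (lineCount (fun j => (i, j)) T + 2) := by
        rw [Finset.sum_add_distrib]; simp [mul_comm]
    _ ≤ _ := Finset.sum_le_sum fun i _ => key i

/-- Of `2 * A` lines in two layers, all but two are met or some layer is completely met. -/
def AlmostFull (A x y : ℕ) : Prop := 2 * A - 2 ≤ x + y ∨ A ≤ x ∨ A ≤ y

theorem almostFull_comm {A x y : ℕ} : AlmostFull A x y ↔ AlmostFull A y x := by
  unfold AlmostFull
  omega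

theorem spinGridGraph_gain_of_bounds (hA : 2 ≤ A) (hB : 3 ≤ B)
    {S : Finset (Fin 2 × (Fin A × Fin B))} (l : Fin 2)
    (ha : ∀ i, lineCount (fun j => (i, j)) (layer S l) ≤ B - 1)
    (ha' : ∀ i, lineCount (fun j => (i, j)) (layer S (1 - l)) ≤ B - 2)
    (hr : ((layer S l).image Prod.fst).card + ((layer S (1 - l)).image Prod.fst).card ≤ 2 * A - 2)
    (hr' : AlmostFull A ((layer S l).image Prod.fst).card
      ((layer S (1 - l)).image Prod.fst).card) :
    S.card + min (4 * A) (3 * A + B - 1) ≤ (twoNbhd (spinGridGraph A B) S).card := by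
  set K := twoNbhd (spinGridGraph A B) S with hK
  have hl : l ≠ 1 - l := by fin_cases l <;> decide
  have g2 : ∀ k i, 0 < lineCount (fun j => (i, j)) (layer S k) →
      min B (lineCount (fun j => (i, j)) (layer S k) + 2) ≤
        lineCount (fun j => (i, j)) (layer K k) := by
    intro k i h
    rw [lineCount_layer] at h ⊢
    rw [lineCount_layer]
    exact lineCount_add_two_le
      (fun j j' hj => spinGridGraph_adj_layer (gridGraph_adj_row i j j' hj)) h
  have gc : ∀ k k' i, k ≠ k' → 0 < lineCount (fun j => (i, j)) (layer S k) →
      min B (lineCount (fun j => (i, j)) (layer S k) + 1) ≤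
        lineCount (fun j => (i, j)) (layer K k') := by
    intro k k' i hk h
    rw [lineCount_layer] at h ⊢
    rw [lineCount_layer]
    exact lineCount_add_one_le
      (fun j j' hj => spinGridGraph_adj_layer (gridGraph_adj_row i j j' hj))
      (fun j => spinGridGraph_adj_cross hk _) h
  have gs : ∀ k (i i' : Fin A), ((i : ℕ) + 1 = i' ∨ (i' : ℕ) + 1 = i) →
      0 < lineCount (fun j => (i, j)) (layer S k) →
      min B (lineCount (fun j => (i, j)) (layer S k) + 1) ≤
        lineCount (fun j => (i', j)) (layer K k) := by
    intro k i i' hi h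
    rw [lineCount_layer] at h ⊢
    rw [lineCount_layer]
    exact lineCount_add_one_le
      (fun j j' hj => spinGridGraph_adj_layer (gridGraph_adj_row i j j' hj))
      (fun j => spinGridGraph_adj_layer (gridGraph_adj_col hi j)) h
  have hz : ∀ k i, i ∈ ((layer S k).image Prod.fst)ᶜ ↔
      (lineCount (fun j => (i, j)) (layer S k) : ℤ) = 0 := by
    intro k i
    rw [Finset.mem_compl, ← lineCount_pos_iff_mem_image_fst]
    omega
  have hcc : ∀ k, ((layer S k).image Prod.fst)ᶜ.card + ((layer S k).image Prod.fst).card = A := by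
    intro k
    rw [Finset.card_compl_add_card, Fintype.card_fin]
  have h1 := hcc l
  have h2 := hcc (1 - l)
  have main := two_layer_gain hA hB
    (fun i => (lineCount (fun j => (i, j)) (layer S l) : ℤ))
    (fun i => (lineCount (fun j => (i, j)) (layer S (1 - l)) : ℤ))
    (fun i => (lineCount (fun j => (i, j)) (layer K l) : ℤ))
    (fun i => (lineCount (fun j => (i, j)) (layer K (1 - l)) : ℤ))
    (fun i => by have := ha i; omega)
    (fun i => by have := ha' i; omega)
    (fun i h => by exact_mod_cast g2 _ i (by exact_mod_cast h))
    (fun i h => by exact_mod_cast g2 _ i (by exact_mod_cast h))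
    (fun i h => by exact_mod_cast gc _ _ i hl (by exact_mod_cast h))
    (fun i h => by exact_mod_cast gc _ _ i hl.symm (by exact_mod_cast h))
    (fun i i' hi h => by exact_mod_cast gs _ i i' hi (by exact_mod_cast h))
    (fun i i' hi h => by exact_mod_cast gs _ i i' hi (by exact_mod_cast h))
    _ _ (hz l) (hz (1 - l)) (by omega) (by unfold AlmostFull at hr'; omega)
  rw [card_eq_card_layer_add S l, card_eq_card_layer_add K l]
  simp only [card_eq_sum_lineCount (layer _ _)]
  rw [Finset.sum_sub_distrib, Finset.sum_sub_distrib] at main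
  zify [show 1 ≤ 3 * A + B by omega]
  linarith

/-- The new vertex must open a new row of its layer. Thus at least two of the `2 * A` rows remain
unmet, and they are exactly two unless one layer is completely met, as `two_layer_gain` requires. -/
theorem spinGridGraph_gain (hA : 2 ≤ A) (hB : 3 ≤ B) {S : Finset (Fin 2 × (Fin A × Fin B))}
    {v : Fin 2 × (Fin A × Fin B)}
    (hr : ¬ AlmostFull A ((layer S 0).image Prod.fst).card ((layer S 1).image Prod.fst).card)
    (hc : ¬ AlmostFull B ((layer S 0).image Prod.snd).card ((layer S 1).image Prod.snd).card)
    (hr' : AlmostFull A ((layer (insert v S) 0).image Prod.fst).card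
      ((layer (insert v S) 1).image Prod.fst).card) :
    (insert v S).card + min (4 * A) (3 * A + B - 1) ≤
      (twoNbhd (spinGridGraph A B) (insert v S)).card := by
  obtain ⟨l, p⟩ := v
  have two : ∀ {l : Fin 2} {P : Fin 2 → Prop}, P l → P (1 - l) → ∀ k, P k := by
    intro l P h1 h2 k
    fin_cases l <;> fin_cases k <;> assumption
  have symm : ∀ (C : ℕ) (F : Fin 2 → ℕ) (k : Fin 2),
      AlmostFull C (F 0) (F 1) ↔ AlmostFull C (F k) (F (1 - k)) := by
    intro C F k
    fin_cases k
    · exact Iff.rfl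
    · exact almostFull_comm
  rw [symm A (fun k => ((layer S k).image Prod.fst).card) l] at hr
  rw [symm A (fun k => ((layer (insert (l, p) S) k).image Prod.fst).card) l] at hr'
  have hne : 1 - l ≠ l := by fin_cases l <;> decide
  have hp : p.1 ∉ (layer S l).image Prod.fst := by
    intro h
    rw [layer_insert_of_ne S hne, layer_insert_same, Finset.image_insert,
      Finset.insert_eq_of_mem h] at hr'
    exact hr hr'
  have hle : ((layer (insert (l, p) S) l).image Prod.fst).card ≤
      ((layer S l).image Prod.fst).card + 1 := by
    rw [layer_insert_same, Finset.image_insert]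
    exact Finset.card_insert_le _ _
  have heq : ((layer (insert (l, p) S) (1 - l)).image Prod.fst).card =
      ((layer S (1 - l)).image Prod.fst).card := by
    rw [layer_insert_of_ne S hne]
  have hbound : ∀ k i, lineCount (fun j => (i, j)) (layer (insert (l, p) S) k) ≤
      max 1 ((layer S k).image Prod.snd).card := by
    refine two (l := l) ?_ ?_
    · intro i
      rw [layer_insert_same]
      exact lineCount_insert_le_of_notMem_image hp i
    · intro i
      rw [layer_insert_of_ne S hne]
      exact (lineCount_le_card_image_snd _ i).trans (le_max_right _ _)
  have hsum : ∀ k, ((layer (insert (l, p) S) k).image Prod.fst).card +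
      ((layer (insert (l, p) S) (1 - k)).image Prod.fst).card ≤ 2 * A - 2 := by
    unfold AlmostFull at hr
    refine two (l := l) ?_ ?_
    · omega
    · rw [sub_sub_cancel]
      omega
  have hfull : ∀ k, AlmostFull A ((layer (insert (l, p) S) k).image Prod.fst).card
      ((layer (insert (l, p) S) (1 - k)).image Prod.fst).card := by
    refine two (l := l) hr' ?_
    rw [sub_sub_cancel]
    exact almostFull_comm.1 hr'
  -- The layers meet at most `2 * B - 3` columns in total, and at most `B - 1` each, so one of them
  -- meets at most `B - 2`.
  obtain ⟨k, hk, hk'⟩ : ∃ k : Fin 2, ((layer S k).image Prod.snd).card ≤ B - 1 ∧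
      ((layer S (1 - k)).image Prod.snd).card ≤ B - 2 := by
    unfold AlmostFull at hc
    by_cases h : ((layer S 1).image Prod.snd).card ≤ B - 2
    · exact ⟨0, by omega, by simpa using h⟩
    · exact ⟨1, by omega, by simp only [sub_self]; omega⟩
  refine spinGridGraph_gain_of_bounds hA hB k (fun i => ?_) (fun i => ?_) (hsum k) (hfull k)
  · have := hbound k i
    omega
  · have := hbound (1 - k) i
    omega

end grid

/-! ### Lower bounds -/

/-- Every edge of `G` lies on a path with two edges. -/
def EdgesExtend {V : Type*} (G : SimpleGraph V) : Prop :=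
  ∀ v w, G.Adj v w → ∃ z, z ≠ v ∧ z ≠ w ∧ (G.Adj z v ∨ G.Adj w z)

theorem edgesExtend_pathGraph {n : ℕ} (hn : 3 ≤ n) : EdgesExtend (SimpleGraph.pathGraph n) := by
  have aux : ∀ i j : Fin n, (i : ℕ) + 1 = j → ∃ z : Fin n, z ≠ i ∧ z ≠ j ∧
      ((SimpleGraph.pathGraph n).Adj z i ∨ (SimpleGraph.pathGraph n).Adj j z) := by
    intro i j hij
    simp only [SimpleGraph.pathGraph_adj, ne_eq, Fin.ext_iff]
    by_cases h : (i : ℕ) = 0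
    · exact ⟨⟨2, by omega⟩, by simp only; omega⟩
    · exact ⟨⟨i - 1, by omega⟩, by simp only; omega⟩
  intro i j hij
  rcases SimpleGraph.pathGraph_adj.1 hij with h | h
  · exact aux i j h
  · obtain ⟨z, h1, h2, h3⟩ := aux j i h
    refine ⟨z, h2, h1, ?_⟩
    rw [SimpleGraph.adj_comm _ z i, SimpleGraph.adj_comm _ j z]
    exact h3.symm

theorem exists_pathGraph_adj {n : ℕ} (hn : 2 ≤ n) (i : Fin n) :
    ∃ j, (SimpleGraph.pathGraph n).Adj i j := by
  simp only [SimpleGraph.pathGraph_adj]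
  by_cases h : (i : ℕ) = 0
  · exact ⟨⟨1, by omega⟩, by simp only; omega⟩
  · exact ⟨⟨i - 1, by omega⟩, by simp only; omega⟩

theorem EdgesExtend.boxProd {V W : Type*} {G : SimpleGraph V} {H : SimpleGraph W}
    (hH : EdgesExtend H) (hdeg : ∀ w, ∃ w', H.Adj w w') : EdgesExtend (G □ H) := by
  rintro ⟨a, b⟩ ⟨a', b'⟩ h
  rw [SimpleGraph.boxProd_adj] at h
  rcases h with ⟨h, hb⟩ | ⟨h, ha⟩
  · simp only at h hb
    subst hb
    obtain ⟨c, hc⟩ := hdeg b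
    refine ⟨(a, c), fun h' => hc.ne (Prod.mk.inj h').2.symm,
      fun h' => hc.ne (Prod.mk.inj h').2.symm, Or.inl ?_⟩
    rw [SimpleGraph.boxProd_adj]
    exact Or.inr ⟨hc.symm, rfl⟩
  · simp only at h ha
    subst ha
    obtain ⟨c, h1, h2, h3⟩ := hH _ _ h
    refine ⟨(a, c), fun h' => h1 (Prod.mk.inj h').2, fun h' => h2 (Prod.mk.inj h').2, ?_⟩
    simp only [SimpleGraph.boxProd_adj]
    tauto

theorem exists_gridGraph_adj {M N : ℕ} (hN : 2 ≤ N) (v : Fin M × Fin N) :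
    ∃ w, (gridGraph M N).Adj v w := by
  obtain ⟨j, hj⟩ := exists_pathGraph_adj hN v.2
  exact ⟨(v.1, j), by rw [SimpleGraph.boxProd_adj]; exact Or.inr ⟨hj, rfl⟩⟩

theorem edgesExtend_gridGraph {M N : ℕ} (hN : 3 ≤ N) : EdgesExtend (gridGraph M N) :=
  (edgesExtend_pathGraph hN).boxProd fun j => exists_pathGraph_adj (by omega) j

theorem edgesExtend_spinGridGraph {M N : ℕ} (hN : 3 ≤ N) : EdgesExtend (spinGridGraph M N) :=
  (edgesExtend_gridGraph hN).boxProd fun v => exists_gridGraph_adj (by omega) v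

/-- Interchanging the two directions. -/
def gridGraphSwap (M N : ℕ) : gridGraph M N ≃g gridGraph N M :=
  SimpleGraph.boxProdComm (SimpleGraph.pathGraph M) (SimpleGraph.pathGraph N)

/-- Interchanging the two long directions. -/
def spinGridGraphSwap (M N : ℕ) : spinGridGraph M N ≃g spinGridGraph N M where
  toEquiv := (Equiv.refl (Fin 2)).prodCongr (Equiv.prodComm (Fin M) (Fin N))
  map_rel_iff' := by
    rintro ⟨l, i, j⟩ ⟨l', i', j'⟩
    simp only [SimpleGraph.boxProd_adj, Equiv.prodCongr_apply, Prod.map, Equiv.refl_apply,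
      Equiv.prodComm_apply, Prod.swap, Prod.mk.injEq]
    tauto

theorem image_fst_map_swap {M N : ℕ} (S : Finset (Fin M × Fin N)) :
    (S.map (gridGraphSwap M N).toEquiv.toEmbedding).image Prod.fst = S.image Prod.snd := by
  ext j
  simp [gridGraphSwap, SimpleGraph.boxProdComm]

theorem image_snd_map_swap {M N : ℕ} (S : Finset (Fin M × Fin N)) :
    (S.map (gridGraphSwap M N).toEquiv.toEmbedding).image Prod.snd = S.image Prod.fst := by
  ext j
  simp [gridGraphSwap, SimpleGraph.boxProdComm]

theorem layer_map_swap {M N : ℕ} (S : Finset (Fin 2 × (Fin M × Fin N))) (l : Fin 2) :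
    layer (S.map (spinGridGraphSwap M N).toEquiv.toEmbedding) l =
      (layer S l).map (gridGraphSwap M N).toEquiv.toEmbedding := by
  ext ⟨j, i⟩
  simp [mem_layer, spinGridGraphSwap, gridGraphSwap, SimpleGraph.boxProdComm]

theorem card_twoNbhd_map {V W : Type*} [Fintype V] [Fintype W] {G : SimpleGraph V}
    {H : SimpleGraph W} (φ : G ≃g H) (S : Finset V) :
    (twoNbhd H (S.map φ.toEquiv.toEmbedding)).card = (twoNbhd G S).card := by
  rw [twoNbhd_map, Finset.card_map]

theorem exists_initialSet_singleton {V : Type*} [Fintype V] [Nonempty V] (r : VertexOrder V) :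
    ∃ v, initialSet r 1 = {v} := by
  refine ⟨r.symm ⟨0, Fintype.card_pos⟩, ?_⟩
  ext v
  rw [mem_initialSet, Finset.mem_singleton, Equiv.eq_symm_apply, Fin.ext_iff]
  simp

theorem lineCount_le_card {V : Type*} [DecidableEq V] {n : ℕ} {f : Fin n → V}
    (hf : Function.Injective f) (S : Finset V) : lineCount f S ≤ S.card := by
  rw [lineCount, ← Finset.card_image_of_injective _ hf]
  refine Finset.card_le_card fun v hv => ?_
  obtain ⟨j, hj, rfl⟩ := Finset.mem_image.1 hv
  simpa using hj

theorem lineCount_layer_le_card {A B : ℕ} (S : Finset (Fin 2 × (Fin A × Fin B))) (l : Fin 2)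
    (i : Fin A) : lineCount (fun j => (l, (i, j))) S ≤ (layer S l).card := by
  rw [← lineCount_layer]
  exact lineCount_le_card (fun a b h => (Prod.mk.inj h).2) _

theorem exists_gain_gridGraph {M N : ℕ} (hM : 1 ≤ M) (hMN : M ≤ N) (hN : 3 ≤ N)
    (r : VertexOrder (Fin M × Fin N)) : ∃ t, (initialSet r t).card + 2 * M ≤
      (twoNbhd (gridGraph M N) (initialSet r t)).card := by
  have : NeZero M := ⟨by omega⟩
  have : NeZero N := ⟨by omega⟩
  -- For a single row the threshold `M - 1` is zero and holds already for the empty set; one vertex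
  -- suffices instead.
  rcases hM.eq_or_lt with rfl | hM2
  · obtain ⟨⟨i, j⟩, hv⟩ := exists_initialSet_singleton r
    refine ⟨1, ?_⟩
    have hpos : 0 < lineCount (fun j => (i, j)) {(i, j)} := lineCount_pos_iff.2 ⟨j, by simp⟩
    have h1 := lineCount_add_two_le (G := gridGraph 1 N) (f := fun j => (i, j)) (gridGraph_adj_row i) hpos
    have h2 := lineCount_le_card (f := fun j => (i, j)) (fun a b h => (Prod.mk.inj h).2)
      (twoNbhd (gridGraph 1 N) {(i, j)})
    rw [hv, Finset.card_singleton]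
    omega
  · obtain ⟨t, v, -, hins, hn, hp⟩ := exists_initialSet_step r
      (fun S => M - 1 ≤ (S.image Prod.fst).card ∨ N - 1 ≤ (S.image Prod.snd).card)
      (by simp; omega)
      (by
        left
        rw [Finset.image_univ_of_surjective Prod.fst_surjective]
        simp)
    refine ⟨t + 1, ?_⟩
    rw [hins] at hp ⊢
    push Not at hn
    by_cases hr : M - 1 ≤ ((insert v (initialSet r t)).image Prod.fst).card
    · exact gridGraph_gain hM2 hN hn.1 hn.2 hr
    · have hc := hp.resolve_left hr
      -- Some row is met although fewer than `M - 1` are, which forces 3 ≤ M, the length bound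
      -- needed after exchanging directions.
      have h1 : 0 < ((insert v (initialSet r t)).image Prod.fst).card :=
        Finset.card_pos.2 ((Finset.insert_nonempty _ _).image _)
      have main := gridGraph_gain (A := N) (B := M) (S := (initialSet r t).map
        (gridGraphSwap M N).toEquiv.toEmbedding)
        (v := (gridGraphSwap M N).toEquiv.toEmbedding v) (by omega) (by omega)
        (by rw [image_fst_map_swap]; exact hn.2) (by rw [image_snd_map_swap]; exact hn.1)
        (by rw [← Finset.map_insert, image_fst_map_swap]; exact hc)
      rw [← Finset.map_insert, Finset.card_map, card_twoNbhd_map] at main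
      omega

theorem exists_gain_spinGridGraph_one {N : ℕ} (hN : 3 ≤ N)
    (r : VertexOrder (Fin 2 × (Fin 1 × Fin N))) : ∃ t, (initialSet r t).card + 4 ≤
      (twoNbhd (spinGridGraph 1 N) (initialSet r t)).card := by
  have : NeZero N := ⟨by omega⟩
  obtain ⟨⟨l, i, j⟩, hv⟩ := exists_initialSet_singleton r
  refine ⟨1, ?_⟩
  have hl : l ≠ 1 - l := by fin_cases l <;> decide
  have hpos : 0 < lineCount (fun j => (l, (i, j))) {(l, (i, j))} :=
    lineCount_pos_iff.2 ⟨j, by simp⟩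
  have hadj : ∀ j j' : Fin N, (j : ℕ) + 1 = j' →
      (spinGridGraph 1 N).Adj (l, (i, j)) (l, (i, j')) := fun j j' h =>
    spinGridGraph_adj_layer (gridGraph_adj_row i j j' h)
  have h1 := lineCount_add_two_le (f := fun j => (l, (i, j))) hadj hpos
  have h2 := lineCount_add_one_le (f := fun j => (l, (i, j))) (f' := fun j => (1 - l, (i, j)))
    hadj (fun j => spinGridGraph_adj_cross hl _) hpos
  have h3 := lineCount_layer_le_card (twoNbhd (spinGridGraph 1 N) {(l, (i, j))}) l i
  have h4 := lineCount_layer_le_card (twoNbhd (spinGridGraph 1 N) {(l, (i, j))}) (1 - l) i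
  rw [hv, Finset.card_singleton, card_eq_card_layer_add _ l]
  omega

/-- Columns of length two are too short for `spinGridGraph_gain` with directions exchanged. Two
vertices are enough here: on a common row the four rows are counted directly, and otherwise the row
version of `spinGridGraph_gain` applies to the second vertex. -/
theorem exists_gain_spinGridGraph_two {N : ℕ} (hN : 3 ≤ N)
    (r : VertexOrder (Fin 2 × (Fin 2 × Fin N))) : ∃ t, (initialSet r t).card + 8 ≤
      (twoNbhd (spinGridGraph 2 N) (initialSet r t)).card := by
  obtain ⟨t, v, hvS, hins, hn, hp⟩ := exists_initialSet_step r (fun S => 2 ≤ S.card)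
    (by simp) (by simp; omega)
  refine ⟨t + 1, ?_⟩
  rw [hins] at hp ⊢
  rw [Finset.card_insert_of_notMem hvS] at hp
  obtain ⟨u, hu⟩ := Finset.card_eq_one.1 (show (initialSet r t).card = 1 by omega)
  rw [hu] at hvS ⊢
  obtain ⟨l, i, j⟩ := u
  obtain ⟨l', i', j'⟩ := v
  have hl : l ≠ 1 - l := by fin_cases l <;> decide
  by_cases hrow : l' = l ∧ i' = i
  · obtain ⟨rfl, rfl⟩ := hrow
    have hjj : j' ≠ j := by simpa using hvS
    set S : Finset (Fin 2 × (Fin 2 × Fin N)) := {(l', (i', j')), (l', (i', j))}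
    have hS : S.card = 2 := Finset.card_pair (by simpa using hjj)
    have hcount : 2 ≤ lineCount (fun j => (l', (i', j))) S := by
      refine (Finset.card_pair hjj).ge.trans (Finset.card_le_card fun x hx => ?_)
      simpa [S] using hx
    have hadj : ∀ j j' : Fin N, (j : ℕ) + 1 = j' →
        (spinGridGraph 2 N).Adj (l', (i', j)) (l', (i', j')) := fun j j' h =>
      spinGridGraph_adj_layer (gridGraph_adj_row i' j j' h)
    have hi : (i' : ℕ) + 1 = (1 - i' : Fin 2) ∨ ((1 - i' : Fin 2) : ℕ) + 1 = i' := by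
      fin_cases i' <;> simp
    have h1 := lineCount_add_two_le (f := fun j => (l', (i', j))) hadj (S := S) (by omega)
    have h2 := lineCount_add_one_le (f := fun j => (l', (i', j)))
      (f' := fun j => (1 - l', (i', j))) hadj (fun j => spinGridGraph_adj_cross hl _) (S := S)
      (by omega)
    have h3 := lineCount_add_one_le (f := fun j => (l', (i', j)))
      (f' := fun j => (l', (1 - i', j))) hadj
      (fun j => spinGridGraph_adj_layer (gridGraph_adj_col hi j)) (S := S) (by omega)
    have h4 := lineCount_le_of_near (G := spinGridGraph 2 N) (f := fun j => (l', (i', j)))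
      (f' := fun j => (1 - l', (1 - i', j))) (S := S) fun j =>
      Or.inr (Or.inr ⟨_, spinGridGraph_adj_layer (gridGraph_adj_col hi j),
        spinGridGraph_adj_cross hl _⟩)
    have two : ∀ F : Fin 2 → ℕ, ∑ k, F k = F i' + F (1 - i') := by
      intro F
      rw [Fin.sum_univ_two]
      fin_cases i'
      · rfl
      · exact add_comm _ _
    rw [hS, card_eq_card_layer_add _ l', card_eq_sum_lineCount, card_eq_sum_lineCount (layer _ (1 - l')),
      two, two]
    simp only [lineCount_layer]
    omega
  · have hone : ∀ k, (layer {(l, (i, j))} k).card ≤ 1 := by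
      intro k
      rw [Finset.card_le_one]
      intro a ha b hb
      simp only [mem_layer, Finset.mem_singleton, Prod.mk.injEq] at ha hb
      rw [ha.2, hb.2]
    have hsum := card_eq_card_layer_add {(l, (i, j))} 0
    rw [Finset.card_singleton, sub_zero] at hsum
    have hle : ∀ (n : ℕ) (F : Fin 2 × Fin N → Fin n) k,
        ((layer {(l, (i, j))} k).image F).card ≤ (layer {(l, (i, j))} k).card :=
      fun n F k => Finset.card_image_le
    have main := spinGridGraph_gain (A := 2) (B := N) le_rfl hN (S := {(l, (i, j))})
      (v := (l', (i', j')))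
      (by
        have h0 := hle 2 Prod.fst 0
        have h1 := hle 2 Prod.fst 1
        unfold AlmostFull
        omega)
      (by
        have h0 := hle N Prod.snd 0
        have h1 := hle N Prod.snd 1
        unfold AlmostFull
        omega)
      (by
        have hm : ∀ k a, (k, a) = (l, i) ∨ (k, a) = (l', i') →
            a ∈ (layer {(l', (i', j')), (l, (i, j))} k).image Prod.fst := by
          rintro k a (h | h)
          · rw [Prod.mk.injEq] at h
            obtain ⟨rfl, rfl⟩ := h
            exact Finset.mem_image.2 ⟨(a, j), by simp [mem_layer], rfl⟩
          · rw [Prod.mk.injEq] at h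
            obtain ⟨rfl, rfl⟩ := h
            exact Finset.mem_image.2 ⟨(a, j'), by simp [mem_layer], rfl⟩
        have h1 := hm l i (Or.inl rfl)
        have h2 := hm l' i' (Or.inr rfl)
        by_cases hll : l' = l
        · subst hll
          have hii : i' ≠ i := fun h => hrow ⟨rfl, h⟩
          have hc : 2 ≤ ((layer {(l', (i', j')), (l', (i, j))} l').image Prod.fst).card := by
            refine (Finset.card_pair hii).ge.trans (Finset.card_le_card fun x hx => ?_)
            rcases Finset.mem_insert.1 hx with rfl | hx
            · exact h2
            · rw [Finset.mem_singleton.1 hx]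
              exact h1
          clear h1 h2 hm
          unfold AlmostFull
          fin_cases l'
          · exact Or.inr (Or.inl hc)
          · exact Or.inr (Or.inr hc)
        · have hpos : ∀ k, 0 < ((layer {(l', (i', j')), (l, (i, j))} k).image Prod.fst).card := by
            intro k
            rcases (show k = l ∨ k = l' by omega) with rfl | rfl
            · exact Finset.card_pos.2 ⟨_, h1⟩
            · exact Finset.card_pos.2 ⟨_, h2⟩
          have hpos0 := hpos 0
          have hpos1 := hpos 1
          left
          omega)
    have : 8 ≤ min (4 * 2) (3 * 2 + N - 1) := by omega
    omega

theorem exists_gain_spinGridGraph {M N : ℕ} (hM : 1 ≤ M) (hMN : M ≤ N) (hN : 3 ≤ N)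
    (r : VertexOrder (Fin 2 × (Fin M × Fin N))) : ∃ t, (initialSet r t).card +
      min (4 * M) (3 * M + N - 1) ≤ (twoNbhd (spinGridGraph M N) (initialSet r t)).card := by
  have : NeZero M := ⟨by omega⟩
  have : NeZero N := ⟨by omega⟩
  rcases (show M = 1 ∨ M = 2 ∨ 3 ≤ M by omega) with rfl | rfl | hM3
  · obtain ⟨t, ht⟩ := exists_gain_spinGridGraph_one hN r
    exact ⟨t, by omega⟩
  · obtain ⟨t, ht⟩ := exists_gain_spinGridGraph_two hN r
    exact ⟨t, by omega⟩
  · obtain ⟨t, v, -, hins, hn, hp⟩ := exists_initialSet_step r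
      (fun S => AlmostFull M ((layer S 0).image Prod.fst).card ((layer S 1).image Prod.fst).card ∨
        AlmostFull N ((layer S 0).image Prod.snd).card ((layer S 1).image Prod.snd).card)
      (by simp [layer, AlmostFull]; omega)
      (by
        left; right; left
        have : layer (univ : Finset (Fin 2 × (Fin M × Fin N))) 0 = univ := by
          ext; simp [mem_layer]
        rw [this, Finset.image_univ_of_surjective Prod.fst_surjective]
        simp)
    refine ⟨t + 1, ?_⟩
    rw [hins] at hp ⊢
    rw [not_or] at hn
    rcases hp with hr | hc
    · exact spinGridGraph_gain (by omega) hN hn.1 hn.2 hr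
    -- The exchanged bound min(4N, 3N + M - 1) is no smaller than the required one since M ≤ N.
    · have main := spinGridGraph_gain (A := N) (B := M)
        (S := (initialSet r t).map (spinGridGraphSwap M N).toEquiv.toEmbedding)
        (v := (spinGridGraphSwap M N).toEquiv.toEmbedding v) (by omega) (by omega)
        (by simp only [layer_map_swap, image_fst_map_swap]; exact hn.2)
        (by simp only [layer_map_swap, image_snd_map_swap]; exact hn.1)
        (by
          simp only [← Finset.map_insert, layer_map_swap, image_fst_map_swap]
          exact hc)
      rw [← Finset.map_insert, Finset.card_map, card_twoNbhd_map] at main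
      omega

/-! ### Upper bounds -/

theorem twoBandwidth_gridGraph_le (M N : ℕ) : twoBandwidth (gridGraph M N) ≤ 2 * M := by
  refine twoBandwidth_le_two_mul (key := fun v => (finProdFinEquiv (v.2, v.1) : ℕ)) ?_ ?_
  · intro v w h
    have := finProdFinEquiv.injective (Fin.ext h)
    exact Prod.ext (Prod.mk.inj this).2 (Prod.mk.inj this).1
  · rintro ⟨i, j⟩ ⟨i', j'⟩ h
    simp only [SimpleGraph.boxProd_adj, SimpleGraph.pathGraph_adj] at h
    simp only [finProdFinEquiv_apply_val]
    have := i.2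
    have := i'.2
    rcases h with ⟨h, rfl⟩ | ⟨h | h, rfl⟩
    · omega
    · rw [← h, mul_add]
      omega
    · rw [← h, mul_add]
      omega

theorem twoBandwidth_spinGridGraph_le (M N : ℕ) :
    twoBandwidth (spinGridGraph M N) ≤ 4 * M := by
  rw [show 4 * M = 2 * (2 * M) by ring]
  refine twoBandwidth_le_two_mul
    (key := fun v => (finProdFinEquiv (v.2.2, finProdFinEquiv (v.1, v.2.1)) : ℕ)) ?_ ?_
  · rintro ⟨l, i, j⟩ ⟨l', i', j'⟩ h
    obtain ⟨h1, h2⟩ := Prod.mk.inj (finProdFinEquiv.injective (Fin.ext h))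
    obtain ⟨h3, h4⟩ := Prod.mk.inj (finProdFinEquiv.injective h2)
    simp only at h1 h3 h4
    rw [h1, h3, h4]
  · rintro ⟨l, i, j⟩ ⟨l', i', j'⟩ h
    simp only [SimpleGraph.boxProd_adj, SimpleGraph.pathGraph_adj, Prod.mk.injEq] at h
    have hx := (finProdFinEquiv (l, i)).2
    have hx' := (finProdFinEquiv (l', i')).2
    simp only [finProdFinEquiv_apply_val] at hx hx' ⊢
    rcases h with ⟨h, -, rfl⟩ | ⟨⟨h, rfl⟩ | ⟨h | h, rfl⟩, rfl⟩
    · omega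
    · omega
    · rw [← h, mul_add]
      omega
    · rw [← h, mul_add]
      omega

/-! ### The diagonal order of the 2 × M × M grid -/

theorem lex_key_lt_iff {n c c' k k' : ℕ} (hk : k < n) (hk' : k' < n) :
    c * n + k < c' * n + k' ↔ c < c' ∨ c = c' ∧ k < k' := by
  rcases lt_trichotomy c c' with h | rfl | h
  · have := Nat.mul_le_mul_right n (Nat.succ_le_of_lt h)
    rw [Nat.succ_mul] at this
    exact ⟨fun _ => Or.inl h, fun _ => by omega⟩
  · simp
  · have := Nat.mul_le_mul_right n (Nat.succ_le_of_lt h)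
    rw [Nat.succ_mul] at this
    exact ⟨fun _ => by omega, fun _ => by omega⟩

/-- The diagonal level of a vertex. -/
def diagLevel {M : ℕ} (v : Fin 2 × (Fin M × Fin M)) : ℕ := v.1 + v.2.1 + v.2.2

/-- The position of a vertex on its diagonal level. -/
def diagIndex {M : ℕ} (v : Fin 2 × (Fin M × Fin M)) : ℕ := 2 * v.2.1 + v.1

theorem diag_ext {M : ℕ} {v w : Fin 2 × (Fin M × Fin M)} (h : diagLevel v = diagLevel w)
    (h' : diagIndex v = diagIndex w) : v = w := by
  obtain ⟨l, i, j⟩ := v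
  obtain ⟨l', i', j'⟩ := w
  simp only [diagLevel, diagIndex] at h h'
  simp only [Prod.mk.injEq, Fin.ext_iff]
  omega

/-- These bounds leave at most 2M - 1 index values on each level; this is where the diagonal order
saves one. -/
theorem diagIndex_bounds {M : ℕ} (v : Fin 2 × (Fin M × Fin M)) :
    diagIndex v < min (2 * M) (2 * diagLevel v + 1) ∧
      2 * diagLevel v + 1 - 2 * M ≤ diagIndex v := by
  obtain ⟨l, i, j⟩ := v
  simp only [diagLevel, diagIndex]
  omega

theorem card_diag_le {M : ℕ} (c a b : ℕ) :
    (univ.filter fun u : Fin 2 × (Fin M × Fin M) =>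
      diagLevel u = c ∧ a ≤ diagIndex u ∧ diagIndex u < b).card ≤ b - a := by
  rw [← Nat.card_Ico]
  refine Finset.card_le_card_of_injOn diagIndex ?_ ?_
  · intro u hu
    simp only [Finset.coe_filter, Finset.mem_univ, true_and, Set.mem_ofPred_eq] at hu
    simpa using hu.2
  · intro u hu w hw h
    simp only [Finset.coe_filter, Finset.mem_univ, true_and, Set.mem_ofPred_eq] at hu hw
    exact diag_ext (hu.1.trans hw.1.symm) h

theorem diag_of_adj {M : ℕ} {v w : Fin 2 × (Fin M × Fin M)} (h : (spinGridGraph M M).Adj v w) :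
    (diagLevel w = diagLevel v + 1 ∧ diagIndex w ≤ diagIndex v + 2) ∨
      diagLevel v = diagLevel w + 1 := by
  obtain ⟨l, i, j⟩ := v
  obtain ⟨l', i', j'⟩ := w
  simp only [SimpleGraph.boxProd_adj, SimpleGraph.pathGraph_adj, Prod.mk.injEq, Fin.ext_iff] at h
  simp only [diagLevel, diagIndex]
  omega

theorem diag_of_near {M : ℕ} {v w : Fin 2 × (Fin M × Fin M)} (h : Near (spinGridGraph M M) v w) :
    diagLevel w ≤ diagLevel v + 1 ∨
      (diagLevel w = diagLevel v + 2 ∧ diagIndex w ≤ diagIndex v + 4) := by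
  rcases h with rfl | h | ⟨z, h, h'⟩
  · omega
  · have := diag_of_adj h
    omega
  · have := diag_of_adj h
    have := diag_of_adj h'
    omega

theorem twoBandwidth_spinGridGraph_self_le {M : ℕ} (hM : 1 ≤ M) :
    twoBandwidth (spinGridGraph M M) ≤ 4 * M - 1 := by
  have hlt : ∀ v w : Fin 2 × (Fin M × Fin M),
      diagLevel v * (2 * M) + diagIndex v < diagLevel w * (2 * M) + diagIndex w ↔
        diagLevel v < diagLevel w ∨ diagLevel v = diagLevel w ∧ diagIndex v < diagIndex w := by
    intro v w
    have := diagIndex_bounds v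
    have := diagIndex_bounds w
    exact lex_key_lt_iff (by omega) (by omega)
  refine twoBandwidth_le_of_key
    (key := fun v : Fin 2 × (Fin M × Fin M) => diagLevel v * (2 * M) + diagIndex v) ?_ ?_
  · intro v w h
    have h1 := hlt v w
    have h2 := hlt w v
    simp only at h
    rw [h] at h1 h2
    simp only [lt_irrefl, false_iff] at h1 h2
    exact diag_ext (by omega) (by omega)
  · intro v w hvw hk
    simp only [hlt] at hk
    set c := diagLevel v
    set a := diagIndex v
    set b := diagIndex w
    have hn := diag_of_near hvw
    have bv := diagIndex_bounds v
    have bw := diagIndex_bounds w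
    have hC := fun c a b => card_diag_le (M := M) c a b
    have hcases : diagLevel w = c ∨ diagLevel w = c + 1 ∨ diagLevel w = c + 2 := by omega
    have reduce : ∀ T : Finset (Fin 2 × (Fin M × Fin M)), (∀ u,
        (c < diagLevel u ∨ c = diagLevel u ∧ a ≤ diagIndex u) →
        (diagLevel u < diagLevel w ∨ diagLevel u = diagLevel w ∧ diagIndex u < b) → u ∈ T) →
        T.card ≤ 4 * M - 1 →
        (univ.filter fun u : Fin 2 × (Fin M × Fin M) => diagLevel v * (2 * M) + diagIndex v ≤
          diagLevel u * (2 * M) + diagIndex u ∧ diagLevel u * (2 * M) + diagIndex u <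
          diagLevel w * (2 * M) + diagIndex w).card ≤ 4 * M - 1 := by
      intro T hT hTc
      refine (Finset.card_le_card fun u hu => ?_).trans hTc
      simp only [Finset.mem_filter, Finset.mem_univ, true_and, hlt, ← not_lt] at hu
      exact hT u (by omega) hu.2
    rcases hcases with h | h | h
    · refine reduce (univ.filter fun u => diagLevel u = c ∧ a ≤ diagIndex u ∧ diagIndex u < b)
        ?_ ?_
      · intro u h1 h2
        simp only [Finset.mem_filter, Finset.mem_univ, true_and]
        omega
      · have := hC c a b
        omega
    · refine reduce
        ((univ.filter fun u => diagLevel u = c ∧ a ≤ diagIndex u ∧ diagIndex u < 2 * M) ∪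
        (univ.filter fun u => diagLevel u = c + 1 ∧ 0 ≤ diagIndex u ∧ diagIndex u < b)) ?_ ?_
      · intro u h1 h2
        have := diagIndex_bounds u
        simp only [Finset.mem_filter, Finset.mem_univ, true_and, Finset.mem_union]
        omega
      · have := hC c a (2 * M)
        have := hC (c + 1) 0 b
        refine (Finset.card_union_le _ _).trans ?_
        omega
    -- Two levels apart, the index grows by at most 4. The count is the tail of level `c`, all of
    -- level `c + 1` and the head of level `c + 2`. The value 4M - 1 arises at c = M - 2, as (2M -
    -- 3) + (2M - 1) + (4 - 1), and at c = M - 1, as (2M - 1) + (2M - 1) + (4 - 3).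
    · refine reduce
        ((univ.filter fun u => diagLevel u = c ∧ a ≤ diagIndex u ∧
          diagIndex u < min (2 * M) (2 * c + 1)) ∪
        ((univ.filter fun u => diagLevel u = c + 1 ∧ 2 * (c + 1) + 1 - 2 * M ≤ diagIndex u ∧
          diagIndex u < min (2 * M) (2 * (c + 1) + 1)) ∪
        (univ.filter fun u => diagLevel u = c + 2 ∧ 2 * (c + 2) + 1 - 2 * M ≤ diagIndex u ∧
          diagIndex u < b))) ?_ ?_
      · intro u h1 h2
        have := diagIndex_bounds u
        simp only [Finset.mem_filter, Finset.mem_univ, true_and, Finset.mem_union]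
        rcases (show diagLevel u = c ∨ diagLevel u = c + 1 ∨ diagLevel u = c + 2 by omega) with
          h3 | h3 | h3
        · rw [h3] at this
          omega
        · rw [h3] at this
          omega
        · rw [h3] at this
          omega
      · have := hC c a (min (2 * M) (2 * c + 1))
        have := hC (c + 1) (2 * (c + 1) + 1 - 2 * M) (min (2 * M) (2 * (c + 1) + 1))
        have := hC (c + 2) (2 * (c + 2) + 1 - 2 * M) b
        refine (Finset.card_union_le _ _).trans
          ((Nat.add_le_add_left (Finset.card_union_le _ _) _).trans ?_)
        omega

/-! ### Small cases -/

instance decidableRelPathGraphAdj (n : ℕ) : DecidableRel (SimpleGraph.pathGraph n).Adj :=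
  fun _ _ => decidable_of_iff _ SimpleGraph.pathGraph_adj.symm

instance decidableRelBoxProdAdj {V W : Type*} [DecidableEq V] [DecidableEq W]
    (G : SimpleGraph V) (H : SimpleGraph W) [DecidableRel G.Adj] [DecidableRel H.Adj] :
    DecidableRel (G □ H).Adj :=
  fun _ _ => decidable_of_iff _ SimpleGraph.boxProd_adj.symm

theorem near_gridGraph_two_two : ∀ u v : Fin 2 × Fin 2, Near (gridGraph 2 2) u v := by
  unfold Near
  decide

theorem near_spinGridGraph_one_two :
    ∀ u v : Fin 2 × (Fin 1 × Fin 2), Near (spinGridGraph 1 2) u v := by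
  unfold Near
  decide

theorem card_neighbors_cube : ∀ u v : Fin 2 × (Fin 2 × Fin 2), u ≠ v →
    4 ≤ (univ.filter fun w => w ≠ u ∧ w ≠ v ∧
      ((spinGridGraph 2 2).Adj u w ∨ (spinGridGraph 2 2).Adj v w)).card := by
  decide +kernel

theorem SwapNetwork.one_le_depth_of_near {V : Type*} [Fintype V] {G : SimpleGraph V}
    (N : SwapNetwork G) (hV : 4 ≤ Fintype.card V) (h : ∀ u v, Near G u v) : 1 ≤ N.depth := by
  by_contra hd
  have hadj : ∀ v w, G.Adj v w → (N.order 0 w : ℕ) ≤ N.order 0 v + 1 := by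
    intro v w hvw
    obtain ⟨t, ht, hvw⟩ := N.adjacent v w hvw
    obtain rfl : t = 0 := by omega
    omega
  have hb : ∀ v w, (N.order 0 w : ℕ) ≤ N.order 0 v + 2 := by
    intro v w
    rcases h v w with rfl | hvw | ⟨z, hvz, hzw⟩
    · omega
    · have := hadj v w hvw
      omega
    · have := hadj v z hvz
      have := hadj z w hzw
      omega
  have := hb ((N.order 0).symm ⟨0, by omega⟩) ((N.order 0).symm ⟨3, by omega⟩)
  simp at this

/-- With depth at most 2 every time is within one layer of the middle time `s`, so adjacent vertices
are at most 3 apart in that order. The at least four further neighbours of the vertices in positions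
0 and 1 would then have to fit into positions 2, 3 and 4. -/
theorem SwapNetwork.three_le_depth_cube (N : SwapNetwork (spinGridGraph 2 2)) : 3 ≤ N.depth := by
  by_contra hd
  obtain ⟨s, hs, hs1⟩ : ∃ s, s = min 1 N.depth ∧ s ≤ N.depth := ⟨_, rfl, by omega⟩
  have hadj : ∀ v w, (spinGridGraph 2 2).Adj v w → (N.order s w : ℕ) ≤ N.order s v + 3 := by
    intro v w hvw
    obtain ⟨t, ht, hvw⟩ := N.adjacent v w hvw
    rcases le_total s t with hst | hst
    · have := N.order_le v hst ht
      have := N.order_le w hst ht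
      omega
    · have := N.order_le v hst hs1
      have := N.order_le w hst hs1
      omega
  have hcard : Fintype.card (Fin 2 × (Fin 2 × Fin 2)) = 8 := by simp
  set r := N.order s
  obtain ⟨u, hu⟩ : ∃ u, (r u : ℕ) = 0 := ⟨r.symm ⟨0, by omega⟩, by simp⟩
  obtain ⟨v, hv⟩ : ∃ v, (r v : ℕ) = 1 := ⟨r.symm ⟨1, by omega⟩, by simp⟩
  have huv : u ≠ v := by rintro rfl; omega
  have h4 := card_neighbors_cube u v huv
  have hinj : Function.Injective fun w => (r w : ℕ) := Fin.val_injective.comp r.injective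
  have hle := Finset.card_le_card_of_injOn (t := Finset.Ico 2 5) (fun w => (r w : ℕ))
    (s := univ.filter fun w => w ≠ u ∧ w ≠ v ∧
      ((spinGridGraph 2 2).Adj u w ∨ (spinGridGraph 2 2).Adj v w)) (by
      intro w hw
      simp only [Finset.coe_filter, Finset.mem_univ, true_and, Set.mem_ofPred_eq] at hw
      obtain ⟨hwu, hwv, hw⟩ := hw
      have h0 : (r w : ℕ) ≠ r u := fun h => hwu (hinj h)
      have h1 : (r w : ℕ) ≠ r v := fun h => hwv (hinj h)
      have h2 : (r w : ℕ) ≤ 4 := by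
        rcases hw with hw | hw
        · have := hadj _ _ hw
          omega
        · have := hadj _ _ hw
          omega
      simp only [Finset.coe_Ico, Set.mem_Ico]
      omega) hinj.injOn
  rw [Nat.card_Ico] at hle
  omega

/-! ### Assembling the bounds -/

theorem mainTheorem2 (M N : ℕ) (hM : 1 ≤ M) (hMN : M ≤ N) :
    (3 ≤ N → twoBandwidth (gridGraph M N) = 2 * M) ∧
    M - 1 ≤ swapDepth (gridGraph M N) ∧
    (3 ≤ N → (M < N → twoBandwidth (spinGridGraph M N) = 4 * M) ∧
      (M = N → twoBandwidth (spinGridGraph M N) = 4 * M - 1)) ∧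
    (2 ≤ N → 2 * M - 1 ≤ swapDepth (spinGridGraph M N)) := by
  have lower₂ : 3 ≤ N → 2 * M ≤ twoBandwidth (gridGraph M N) := fun hN =>
    le_twoBandwidth (by omega) (edgesExtend_gridGraph hN) (exists_gain_gridGraph hM hMN hN)
  have lower₃ : 3 ≤ N → min (4 * M) (3 * M + N - 1) ≤ twoBandwidth (spinGridGraph M N) :=
    fun hN => le_twoBandwidth (by omega) (edgesExtend_spinGridGraph hN)
      (exists_gain_spinGridGraph hM hMN hN)
  refine ⟨fun hN => le_antisymm (twoBandwidth_gridGraph_le M N) (lower₂ hN), ?_,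
    fun hN => ⟨fun h => le_antisymm (twoBandwidth_spinGridGraph_le M N) ?_, fun h => ?_⟩,
    fun hN => ?_⟩
  · refine le_swapDepth fun S => ?_
    rcases le_or_gt 3 N with hN | hN
    · have := lower₂ hN
      have := S.twoBandwidth_le
      omega
    · rcases hM.eq_or_lt with rfl | hM2
      · omega
      · obtain rfl : M = 2 := by omega
        obtain rfl : N = 2 := by omega
        exact S.one_le_depth_of_near (by simp) near_gridGraph_two_two
  · have := lower₃ hN
    omega
  · subst h
    have := lower₃ hN
    have := twoBandwidth_spinGridGraph_self_le hM
    omega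
  · refine le_swapDepth fun S => ?_
    rcases hN.eq_or_lt with rfl | hN3
    · rcases (show M = 1 ∨ M = 2 by omega) with rfl | rfl
      · exact S.one_le_depth_of_near (by simp) near_spinGridGraph_one_two
      · exact S.three_le_depth_cube
    -- Also for M = N nothing is lost: 4M - 1 ≤ 2d + 2 gives d ≥ 2M - 1 by parity.
    · have := lower₃ hN3
      have := S.twoBandwidth_le
      omega
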